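/- Let $\mathbb F_q$ be a finite field and let $f,g\in\mathbb F_q[T]$ with $\deg f=a$, $\deg g=b$, $0<a<b$ and $\gcd(a,b)=1$. Let $\mathcal X$ be the nonsingular projective curve over $\mathbb F_q$ with affine equation $f(y)=g(x)$, i.e. the curve whose function field is the fraction field of $\mathbb F_q[x,y]/(f(y)-g(x))$. Let $P$ be a rational point of $\mathcal X$ such that the functions $x,y$ have pole divisors $\operatorname{div}_\infty(x)=aP$, $\operatorname{div}_\infty(y)=bP$, and such that the Weierstrass semigroup $H(P)=\{n\ge 0:\ \exists h,\ \operatorname{div}_\infty(h)=nP\}$ equals $\langle a,b\rangle$. Let $\sigma$ be an automorphism of $\mathcal X$ over $\mathbb F_q$ with $\sigma(x)=\alpha x$, $\sigma(y)=\alpha^t y$, where $\alpha\in\mathbb F_q^*$ and $t\ge 0$. Let $D$ be the sum of all rational points of $\mathcal X$ other than $P$, and let $O_1,\dots,O_{r+s}$ be the orbits of $\sigma$ on the support of $D$, numbered so that $O_1,\dots,O_r$ are exactly the orbits of points with both coordinates nonzero. Choose $P_{i,0}\in O_i$ and put $P_{i,j}=\sigma^j(P_{i,0})$. Suppose that for some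 integers $\rho_1,\rho_2,\rho_3\ge 0$: - for each $1\le i\le r$ there is a polynomial $M_i(y)$ such that $O_i$ is the intersection of $\mathcal X\setminus\{P\}$ with the curve $M_i(y)=0$, each point being counted with multiplicity one (the zero divisor of $M_i(y)$ is $\sum_{Q\in O_i}Q$), such that $M_i(y)$ is a nonzero constant on each $O_k$, $k\neq i$, and such that $\operatorname{div}_\infty(M_i)=\rho_1 b\,P$; - for each $1\le i\le r$ and $0\le j<\operatorname{ord}(\alpha)$ there is a polynomial $B_{i,j}(x,y)$ that vanishes at every point of $O_i$ except $P_{i,j}$, and $\operatorname{div}_\infty(B_{i,j})=(\rho_2a+\rho_3b)P$. Let $\lambda\ge 0$ be an integer smaller than the number $N$ of rational points of $\mathcal X$, and let $C=C(D,\lambda P)$ be the code of all words $(h(Q))_{Q\in\operatorname{Supp}D}$ with $h\in\mathcal L(\lambda P)$. Let $\overline C\subseteq\mathbb F_q[t]^{r+s}$ be the preimage, under the natural map to $\bigoplus_i\mathbb F_q[t]/(t^{|O_i|}-1)$, of the set of tuples $\bigl(\sum_{j<|O_i|}h(P_{i,j})t^j\bigr)_{i}$, $h\in\mathcal L(\lambda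 P)$. Let $\mathbf g_1,\dots,\mathbf g_{r+s}$ be any Gröbner basis of $\overline C$ for the position-over-term order with $\mathbf e_1>\dots>\mathbf e_{r+s}$ of the form $\mathbf g_i=(0,\dots,0,g_i^{(i)},g_i^{(i+1)},\dots,g_i^{(r+s)})$. The root diagram of $C$ has $r+s$ rows; the boxes of row $i$ are the roots of $t^{|O_i|}-1$ in $\mathbb F_q^*$, and a box is marked if it is a root of $g_i^{(i)}$. A row is full if all its boxes are marked and empty if none is. **Theorem.** Let $i\in\{1,\dots,r\}$ satisfy $$(i-1)\rho_1b\ \le\ \lambda\ <\ \rho_2a+\rho_3b+(i-1)\rho_1b .$$ Then row $i$ of the root diagram is not full, and the set of its unmarked boxes is exactly $$E_i=\{\alpha^{-(\beta+\gamma b)}:\ 0\le\beta\le b-1,\ 0\le\gamma\le\rho_1-1,\ (i-1)\rho_1b+\beta a+\gamma b\le\lambda\}.$$ Moreover row $i$ is not empty, provided that the polynomials $B_{i,j}$ of that row have the least possible pole order, i.e. for each $j$, every polynomial in $x,y$ that vanishes at every point of $O_i$ except $P_{i,j}$ has pole divisor $nP$ with $n\ge\rho_2a+\rho_3b$. -/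

import Mathlib

open Polynomial

namespace AGCode

section Places

/-- A place of the function field `F / k` (a closed point of the nonsingular projective curve with
function field `F`), given by its normalized discrete valuation, written multiplicatively:
`v h = exp (-ord h)`. -/
@[ext]
structure Place (k F : Type*) [Field k] [Field F] [Algebra k F] where
  v : Valuation F (WithZero (Multiplicative ℤ))
  surj : Function.Surjective v
  triv : ∀ c : k, c ≠ 0 → v (algebraMap k F c) = 1

variable {k F : Type*} [Field k] [Field F] [Algebra k F]

namespace Place

/-- Order of vanishing of `h` at the place `Q` (meaningful for `h ≠ 0`). -/
noncomputable def ord (Q : Place k F) (h : F) : ℤ := -WithZero.log (Q.v h)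

/-- Coefficient of `Q` in the divisor of zeros of `h ≠ 0`. -/
noncomputable def zeroOrder (Q : Place k F) (h : F) : ℕ := (Q.ord h).toNat

/-- Coefficient of `Q` in the divisor of poles of `h ≠ 0`. -/
noncomputable def poleOrder (Q : Place k F) (h : F) : ℕ := (-Q.ord h).toNat

/-- `Q` is a rational point: its residue field is `k`. -/
def IsRational (Q : Place k F) : Prop :=
  ∀ h : F, Q.v h ≤ 1 → ∃ c : k, Q.v (h - algebraMap k F c) < 1

open Classical in
/-- The value `h(Q) ∈ k` of `h` at a rational point `Q` at which `h` is regular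
(`0` if there is no such value). -/
noncomputable def eval (Q : Place k F) (h : F) : k :=
  if H : ∃ c : k, Q.v (h - algebraMap k F c) < 1 then H.choose else 0

/-- The image of the point `Q` under the automorphism of the curve whose pull-back on functions
is `σ`; thus `h (σ Q) = (σ h) (Q)`. -/
noncomputable def act (σ : F ≃ₐ[k] F) (Q : Place k F) : Place k F where
  v := Q.v.comap (σ : F →+* F)
  surj := fun z => by
    obtain ⟨h, rfl⟩ := Q.surj z
    exact ⟨σ.symm h, by simp [Valuation.comap_apply]⟩
  triv := fun c hc => by
    simpa [Valuation.comap_apply] using Q.triv c hc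

/-- The orbit of `Q` under (the finite cyclic group generated by) `σ`. -/
def orbit (σ : F ≃ₐ[k] F) (Q : Place k F) : Set (Place k F) :=
  {R | ∃ j : ℕ, R = act (σ ^ j) Q}

end Place

/-- The divisor of poles of `h` is `n P`. -/
def HasPoleDivisor (h : F) (P : Place k F) (n : ℕ) : Prop :=
  h ≠ 0 ∧ P.poleOrder h = n ∧ ∀ Q : Place k F, Q ≠ P → Q.poleOrder h = 0

/-- The Weierstrass semigroup `H(P)`. -/
def weierstrassSemigroup (P : Place k F) : Set ℕ :=
  {n | ∃ h : F, HasPoleDivisor h P n}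

/-- The Riemann-Roch space of the divisor `G`: all `h` with `h = 0` or `div h + G ≥ 0`. -/
def riemannRochSpace (G : Place k F →₀ ℤ) : Set F :=
  {h | h = 0 ∨ ∀ Q : Place k F, 0 ≤ Q.ord h + G Q}

/-- The algebraic geometry code `C(D, G)`; here `D` is the set of evaluation points (the support
of the reduced divisor `D`), and codewords are indexed by it. -/
def agCode (D : Set (Place k F)) (G : Place k F →₀ ℤ) : Set (D → k) :=
  {c | ∃ h ∈ riemannRochSpace G, ∀ R : D, c R = R.1.eval h}

/-- All rational points other than `P`. -/
def ratPointsExcept (P : Place k F) : Set (Place k F) :=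
  {R | R.IsRational ∧ R ≠ P}

/-- The one-point code `C(D, lam P)`, with `D` the sum of all rational points other than `P`. -/
noncomputable def onePointCode (P : Place k F) (lam : ℕ) : Set (ratPointsExcept P → k) :=
  agCode (ratPointsExcept P) (Finsupp.single P (lam : ℤ))

/-- `Q 0, …, Q (n-1)` are base points of the distinct orbits of `σ` on the set `D`. -/
def IsOrbitDecomposition (σ : F ≃ₐ[k] F) (D : Set (Place k F)) {n : ℕ}
    (Q : Fin n → Place k F) : Prop :=
  (∀ i, Place.orbit σ (Q i) ⊆ D) ∧ ∀ R ∈ D, ∃! i, R ∈ Place.orbit σ (Q i)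

/-- For a word `c` indexed by `D`, the polynomial `h_i(t) = ∑_j c(P_{i,j}) t^j` over the orbit of
`Q = P_{i,0}`, where `P_{i,j} = σ^j(Q)`. -/
noncomputable def orbitPoly (σ : F ≃ₐ[k] F) (D : Set (Place k F)) (Q : Place k F)
    (c : D → k) : k[X] :=
  ∑ j ∈ Finset.range (Place.orbit σ Q).ncard,
    Polynomial.C (Function.extend Subtype.val c 0 (Place.act (σ ^ j) Q)) * Polynomial.X ^ j

/-- (The underlying set of) the submodule of `k[t]^n` attached to a code: the preimage of the
set of all tuples `(h_1, …, h_n)` under `k[t]^n → ⨁ k[t] / (t^{|O_i|} - 1)`. -/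
def codeModule (σ : F ≃ₐ[k] F) (D : Set (Place k F)) {n : ℕ} (Q : Fin n → Place k F)
    (C : Set (D → k)) : Set (Fin n → k[X]) :=
  {p | ∃ c ∈ C, ∀ i,
    (Polynomial.X ^ (Place.orbit σ (Q i)).ncard - 1 : k[X]) ∣ p i - orbitPoly σ D (Q i) c}

end Places

section Groebner

variable {k : Type*} [Field k]

open Classical in
/-- The leading term of `p ∈ k[t]^n` for the position-over-term order with `e_1 > e_2 > ⋯ > e_n`:
the leading term of the first nonzero component, in that position (and `0` for `p = 0`). -/
noncomputable def potLT {n : ℕ} (p : Fin n → k[X]) : Fin n → k[X] := fun i =>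
  if ∀ j < i, p j = 0 then Polynomial.monomial (p i).natDegree (p i).leadingCoeff else 0

/-- `G_1, …, G_n` is a Groebner basis of `M` for the position-over-term order, of triangular shape
`G_i = (0, …, 0, G_i^{(i)}, G_i^{(i+1)}, …)`. -/
def IsTriangularGroebnerBasis {n : ℕ} (M : Set (Fin n → k[X])) (G : Fin n → Fin n → k[X]) : Prop :=
  (∀ i, G i ∈ M) ∧
  Submodule.span k[X] (Set.range fun i => potLT (G i)) = Submodule.span k[X] (potLT '' M) ∧
  ∀ i j, j < i → G i j = 0

/-- The boxes of a row of the root diagram with orbit length `m`: the roots of `t^m - 1`. -/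
def boxes (k : Type*) [Field k] (m : ℕ) : Set k := {c | c ≠ 0 ∧ c ^ m = 1}

/-- The marked boxes: those which are roots of the diagonal entry `p` of the Groebner basis. -/
def markedBoxes (m : ℕ) (p : k[X]) : Set k := {c | c ∈ boxes k m ∧ p.eval c = 0}

end Groebner

section PlaneCurve

variable {k : Type*} [Field k]

/-- The affine coordinate ring `k[x, y] / (f(y) - g(x))`, with `x = X 0` and `y = X 1`. -/
abbrev CoordRing (f g : k[X]) : Type _ :=
  MvPolynomial (Fin 2) k ⧸
    Ideal.span {Polynomial.aeval (MvPolynomial.X 1 : MvPolynomial (Fin 2) k) f -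
      Polynomial.aeval (MvPolynomial.X 0 : MvPolynomial (Fin 2) k) g}

/-- The function on the curve given by a polynomial in `x` and `y`. -/
noncomputable def fn (f g : k[X]) (F : Type*) [Field F] [Algebra (CoordRing f g) F]
    (p : MvPolynomial (Fin 2) k) : F :=
  algebraMap (CoordRing f g) F (Ideal.Quotient.mk _ p)

/-- The function `x` on the curve. -/
noncomputable def xFn (f g : k[X]) (F : Type*) [Field F] [Algebra (CoordRing f g) F] : F :=
  fn f g F (MvPolynomial.X 0)

/-- The function `y` on the curve. -/
noncomputable def yFn (f g : k[X]) (F : Type*) [Field F] [Algebra (CoordRing f g) F] : F :=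
  fn f g F (MvPolynomial.X 1)

/-- The function `m(y)` on the curve, for a polynomial `m` in one variable. -/
noncomputable def polyY (f g : k[X]) (F : Type*) [Field F] [Algebra (CoordRing f g) F]
    (m : k[X]) : F :=
  fn f g F (Polynomial.aeval (MvPolynomial.X 1 : MvPolynomial (Fin 2) k) m)

end PlaneCurve

/-- The function `h` vanishes at all points of the orbit of `Q` except at `σ^j(Q)`. -/
def VanishesExceptAt {k F : Type*} [Field k] [Field F] [Algebra k F] (σ : F ≃ₐ[k] F)
    (Q : Place k F) (j : ℕ) (h : F) : Prop :=
  ∀ R ∈ Place.orbit σ Q, R.eval h = 0 ↔ R ≠ Place.act (σ ^ j) Q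

end AGCode

open AGCode

namespace AGCode

open WithZero

section Places

variable {k F : Type*} [Field k] [Field F] [Algebra k F]

/-! ### Valuations of places -/

namespace Place

/-! The diagonal entry of row i generates the ideal of i-th components of those module elements
whose earlier components vanish. Hence a box c is unmarked exactly when some h in L(λP) vanishes on
the orbits before O_i and has ∑_j h(P_{i,j}) c^j ≠ 0 (`mem_boxes_diff_markedBoxes`). Such h are the
products W h', where W is the product of the M_l(y) over l < i (`exists_eq_prod_mul`). Since W is a
nonzero constant on O_i and has pole order (i-1)ρ₁b, h' runs over L((λ-(i-1)ρ₁b)P), which is spanned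
by monomials x^β y^γ with β < b because H(P) = ⟨a,b⟩ (`mem_span_monomials`). On O_i a monomial is a
nonzero multiple of the character j ↦ α^{(β+tγ)j}, so its sum against c^j is a geometric sum,
nonzero only for c = α^{-(β+tγ)}.

To reach E_i one needs α^t = α^b and α^{tρ₁} = 1. Both rest on `exponent_injective`: if two
monomials with β < b, γ < ρ₁ gave the same character, a combination of them would vanish on O_i and
be divisible by M_i(y), which its pole order forbids. Counting roots of M_i then shows that α^t has
order exactly ρ₁ (`pow_orbit_length`). For `pow_t_eq_pow_b`, σ is applied to f(y) = g(x) and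
coefficients are compared; the only case left over is a curve singular at a point with y = 0, where
x^{b-1}/y would have the Frobenius number ab-a-b as pole order.

The constant 1 gives an unmarked box, so the row is not full. If every box were unmarked, every
character of O_i would come from a monomial of pole order below ρ₂a+ρ₃b, and adding these monomials,
suitably scaled, would produce a function supported at one point of O_i, against the minimality of
the B_{i,j} (`exists_vanishesExceptAt`). -/

instance (Q : Place k F) : Q.v.IsTrivialOn k := ⟨fun c hc => Q.triv c hc⟩

lemma v_algebraMap_le (Q : Place k F) (c : k) : Q.v (algebraMap k F c) ≤ 1 := by
  by_cases hc : c = 0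
  · simp [hc]
  · exact (Q.triv c hc).le

lemma v_algebraMap_lt_one_iff {Q : Place k F} {c : k} : Q.v (algebraMap k F c) < 1 ↔ c = 0 := by
  refine ⟨fun h => by_contra fun hc => h.ne (Q.triv c hc), fun h => by simp [h]⟩

lemma eval_eq {Q : Place k F} {h : F} {c : k} (hc : Q.v (h - algebraMap k F c) < 1) :
    Q.eval h = c := by
  have H : ∃ c : k, Q.v (h - algebraMap k F c) < 1 := ⟨c, hc⟩
  rw [eval, dif_pos H]
  have h1 := Q.v.map_sub_lt hc H.choose_spec
  rw [sub_sub_sub_cancel_left, ← map_sub, v_algebraMap_lt_one_iff, sub_eq_zero] at h1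
  exact h1

lemma IsRational.v_sub_eval_lt {Q : Place k F} (hQ : Q.IsRational) {h : F} (hh : Q.v h ≤ 1) :
    Q.v (h - algebraMap k F (Q.eval h)) < 1 := by
  obtain ⟨c, hc⟩ := hQ h hh
  rwa [eval_eq hc]

lemma eval_algebraMap (Q : Place k F) (c : k) : Q.eval (algebraMap k F c) = c :=
  eval_eq (by simp)

lemma IsRational.eval_add {Q : Place k F} (hQ : Q.IsRational) {h₁ h₂ : F} (hh₁ : Q.v h₁ ≤ 1)
    (hh₂ : Q.v h₂ ≤ 1) : Q.eval (h₁ + h₂) = Q.eval h₁ + Q.eval h₂ := by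
  apply eval_eq
  rw [map_add, add_sub_add_comm]
  exact Q.v.map_add_lt (hQ.v_sub_eval_lt hh₁) (hQ.v_sub_eval_lt hh₂)

lemma IsRational.eval_mul {Q : Place k F} (hQ : Q.IsRational) {h₁ h₂ : F} (hh₁ : Q.v h₁ ≤ 1)
    (hh₂ : Q.v h₂ ≤ 1) : Q.eval (h₁ * h₂) = Q.eval h₁ * Q.eval h₂ := by
  apply eval_eq
  have e : h₁ * h₂ - algebraMap k F (Q.eval h₁ * Q.eval h₂) =
      h₁ * (h₂ - algebraMap k F (Q.eval h₂)) +
        algebraMap k F (Q.eval h₂) * (h₁ - algebraMap k F (Q.eval h₁)) := by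
    rw [map_mul]; ring
  rw [e]
  apply Q.v.map_add_lt
  · rw [map_mul]
    exact (mul_le_of_le_one_left' hh₁).trans_lt (hQ.v_sub_eval_lt hh₂)
  · rw [map_mul]
    exact (mul_le_of_le_one_left' (Q.v_algebraMap_le _)).trans_lt (hQ.v_sub_eval_lt hh₁)

lemma IsRational.eval_eq_zero_iff {Q : Place k F} (hQ : Q.IsRational) {h : F} (hh : Q.v h ≤ 1) :
    Q.eval h = 0 ↔ Q.v h < 1 := by
  refine ⟨fun h0 => ?_, fun h0 => eval_eq (by simpa using h0)⟩
  simpa [h0] using hQ.v_sub_eval_lt hh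

lemma act_v (σ : F ≃ₐ[k] F) (Q : Place k F) (h : F) : (act σ Q).v h = Q.v (σ h) := rfl

lemma act_eval (σ : F ≃ₐ[k] F) (Q : Place k F) (h : F) : (act σ Q).eval h = Q.eval (σ h) := by
  have e : ∀ c : k, (act σ Q).v (h - algebraMap k F c) = Q.v (σ h - algebraMap k F c) :=
    fun c => by rw [act_v, map_sub, AlgEquiv.commutes]
  by_cases H : ∃ c : k, Q.v (σ h - algebraMap k F c) < 1
  · obtain ⟨c, hc⟩ := H
    rw [eval_eq hc, eval_eq (by rwa [e])]
  · have H' : ¬ ∃ c : k, (act σ Q).v (h - algebraMap k F c) < 1 := by simpa only [e] using H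
    rw [eval, eval, dif_neg H, dif_neg H']

lemma act_mul (σ τ : F ≃ₐ[k] F) (Q : Place k F) : act (σ * τ) Q = act τ (act σ Q) := rfl

lemma act_one (Q : Place k F) : act (1 : F ≃ₐ[k] F) Q = Q := rfl

lemma act_pow (σ : F ≃ₐ[k] F) (Q : Place k F) (j : ℕ) : act (σ ^ j) Q = (act σ)^[j] Q := by
  induction j with
  | zero => rfl
  | succ j ih => rw [pow_succ, act_mul, ih, Function.iterate_succ_apply']

lemma act_mem_orbit (σ : F ≃ₐ[k] F) (Q : Place k F) (j : ℕ) : act (σ ^ j) Q ∈ orbit σ Q := ⟨j, rfl⟩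

lemma ncard_orbit (σ : F ≃ₐ[k] F) (Q : Place k F)
    (hQ : Q ∈ Function.periodicPts (act σ)) :
    (orbit σ Q).ncard = Function.minimalPeriod (act σ) Q := by
  have e : orbit σ Q =
      ((fun j => (act σ)^[j] Q) '' (Finset.range (Function.minimalPeriod (act σ) Q) : Set ℕ)) := by
    ext R
    simp only [orbit, act_pow, Set.mem_ofPred_eq, Set.mem_image, Finset.coe_range, Set.mem_Iio]
    constructor
    · rintro ⟨j, rfl⟩
      exact ⟨j % Function.minimalPeriod (act σ) Q,
        Nat.mod_lt _ (Function.minimalPeriod_pos_of_mem_periodicPts hQ),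
        Function.iterate_mod_minimalPeriod_eq⟩
    · rintro ⟨j, -, rfl⟩
      exact ⟨j, rfl⟩
  rw [e, Set.InjOn.ncard_image, Set.ncard_coe_finset, Finset.card_range]
  intro i hi j hj h
  exact Function.iterate_injOn_Iio_minimalPeriod (by simpa using hi) (by simpa using hj) h

end Place

/-! ### Functions regular outside a point -/

/-- The ring of functions without poles outside `P`. -/
def regularOutside (P : Place k F) : Subalgebra k F where
  carrier := {h | ∀ Q : Place k F, Q ≠ P → Q.v h ≤ 1}
  mul_mem' {h₁ h₂} hh₁ hh₂ Q hQ := by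
    rw [map_mul]; exact mul_le_one' (hh₁ Q hQ) (hh₂ Q hQ)
  add_mem' {h₁ h₂} hh₁ hh₂ Q hQ := Q.v.map_add_le (hh₁ Q hQ) (hh₂ Q hQ)
  algebraMap_mem' c Q _ := Q.v_algebraMap_le c

lemma mem_regularOutside {P : Place k F} {h : F} :
    h ∈ regularOutside P ↔ ∀ Q : Place k F, Q ≠ P → Q.v h ≤ 1 := Iff.rfl

lemma Place.poleOrder_eq (Q : Place k F) (h : F) : Q.poleOrder h = (log (Q.v h)).toNat := by
  simp [Place.poleOrder, Place.ord]

lemma Place.poleOrder_eq_zero_iff {Q : Place k F} {h : F} : Q.poleOrder h = 0 ↔ Q.v h ≤ 1 := by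
  rw [Place.poleOrder_eq, Int.toNat_eq_zero]
  by_cases hh : h = 0
  · simp [hh]
  · rw [log_le_iff_le_exp (by simpa using hh), exp_zero]

/-- Positivity of `n` matters: `poleOrder` is truncated at zero, so the value 0 only says that `h`
is regular at `Q`. -/
lemma Place.v_eq_exp_of_poleOrder {Q : Place k F} {h : F} {n : ℕ} (hn : 0 < n)
    (h' : Q.poleOrder h = n) : Q.v h = exp (n : ℤ) := by
  have h0 : Q.v h ≠ 0 := by
    intro h0
    simp [Place.poleOrder_eq, h0] at h'
    omega
  rw [Place.poleOrder_eq] at h'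
  have : log (Q.v h) = n := by omega
  rw [← this, exp_log h0]

lemma Place.poleOrder_le_of_v_le {Q : Place k F} {h : F} {n : ℕ} (hv : Q.v h ≤ exp (n : ℤ)) :
    Q.poleOrder h ≤ n := by
  rw [Place.poleOrder_eq, Int.toNat_le]
  by_cases hh : h = 0
  · simp [hh]
  · rwa [log_le_iff_le_exp (by simpa using hh)]

lemma HasPoleDivisor.mem_regularOutside {P : Place k F} {h : F} {n : ℕ}
    (hh : HasPoleDivisor h P n) : h ∈ regularOutside P :=
  fun Q hQ => Place.poleOrder_eq_zero_iff.1 (hh.2.2 Q hQ)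

lemma HasPoleDivisor.v_eq {P : Place k F} {h : F} {n : ℕ}
    (hh : HasPoleDivisor h P n) (hn : 0 < n) : P.v h = exp (n : ℤ) :=
  Place.v_eq_exp_of_poleOrder hn hh.2.1

lemma hasPoleDivisor_poleOrder {P : Place k F} {h : F} (h0 : h ≠ 0) (hh : h ∈ regularOutside P) :
    HasPoleDivisor h P (P.poleOrder h) :=
  ⟨h0, rfl, fun Q hQ => Place.poleOrder_eq_zero_iff.2 (hh Q hQ)⟩

lemma hasPoleDivisor_of_v_eq {P : Place k F} {h : F} {n : ℕ} (hh : h ∈ regularOutside P)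
    (hv : P.v h = exp (n : ℤ)) : HasPoleDivisor h P n := by
  have h0 : h ≠ 0 := by
    rintro rfl
    exact exp_ne_zero (hv.symm.trans P.v.map_zero)
  have := hasPoleDivisor_poleOrder h0 hh
  rwa [Place.poleOrder_eq, hv, log_exp, Int.toNat_natCast] at this

lemma mem_riemannRochSpace_single {P : Place k F} {h : F} {n : ℕ} :
    h ∈ riemannRochSpace (Finsupp.single P (n : ℤ)) ↔
      h ∈ regularOutside P ∧ P.v h ≤ exp (n : ℤ) := by
  by_cases h0 : h = 0
  · simp [h0, riemannRochSpace, zero_mem]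
  have key : ∀ Q : Place k F, ∀ m : ℤ, 0 ≤ Q.ord h + m ↔ Q.v h ≤ exp m := fun Q m => by
    rw [Place.ord, ← log_le_iff_le_exp (by simpa using h0)]
    constructor <;> intro <;> omega
  simp only [riemannRochSpace, Set.mem_ofPred_eq, h0, false_or, key]
  constructor
  · intro H
    refine ⟨fun Q hQ => ?_, by simpa using H P⟩
    simpa [Finsupp.single_eq_of_ne hQ] using H Q
  · rintro ⟨H1, H2⟩ Q
    by_cases hQ : Q = P
    · subst hQ; simpa using H2
    · simpa [Finsupp.single_eq_of_ne hQ] using H1 Q hQ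

lemma Place.zeroOrder_eq (Q : Place k F) (h : F) : Q.zeroOrder h = (-log (Q.v h)).toNat := rfl

lemma Place.v_eq_of_zeroOrder_eq_one {Q : Place k F} {h : F} (hh : Q.zeroOrder h = 1) :
    Q.v h = exp (-1 : ℤ) := by
  rw [Place.zeroOrder_eq] at hh
  have h0 : Q.v h ≠ 0 := by
    intro h0
    simp [h0] at hh
  have : log (Q.v h) = -1 := by omega
  rw [← this, exp_log h0]

lemma Place.v_eq_one_of_orders {Q : Place k F} {h : F} (h0 : h ≠ 0) (hz : Q.zeroOrder h = 0)
    (hp : Q.poleOrder h = 0) : Q.v h = 1 := by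
  rw [Place.zeroOrder_eq] at hz
  rw [Place.poleOrder_eq] at hp
  have : log (Q.v h) = 0 := by omega
  rw [← exp_log (x := Q.v h) (by simpa using h0), this, exp_zero]

lemma lt_one_iff_le_exp_neg_one {x : WithZero (Multiplicative ℤ)} :
    x < 1 ↔ x ≤ exp (-1 : ℤ) := by
  have h : (1 : WithZero (Multiplicative ℤ)) = exp (-1 : ℤ) * exp 1 := by
    rw [← exp_add]; simp
  rw [h, lt_mul_exp_iff_le (by simp)]

lemma lt_exp_iff_le_exp_sub_one {x : WithZero (Multiplicative ℤ)} {n : ℤ} :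
    x < exp n ↔ x ≤ exp (n - 1) := by
  have h : exp n = exp (n - 1) * exp (1 : ℤ) := by
    rw [← exp_add]; simp
  rw [h, lt_mul_exp_iff_le (by simp)]

end Places

section PlaneModel

/-! ### Numerical semigroups with two generators -/

/-- Any b copies of `a` can be traded for a copies of `b`, so the coefficient of `a` may be reduced
modulo `b`. -/
lemma exists_eq_mul_add_mul_of_mem_closure {a b n : ℕ} (hb : 0 < b)
    (h : n ∈ AddSubmonoid.closure ({a, b} : Set ℕ)) :
    ∃ β γ : ℕ, β < b ∧ n = β * a + γ * b := by
  obtain ⟨u, w, rfl⟩ := (AddSubmonoid.mem_closure_pair a b n).1 h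
  refine ⟨u % b, w + a * (u / b), Nat.mod_lt _ hb, ?_⟩
  have := Nat.mod_add_div u b
  simp only [smul_eq_mul]
  calc u * a + w * b = (u % b + b * (u / b)) * a + w * b := by rw [this]
    _ = _ := by ring

lemma mul_add_mul_injective {a b β γ β' γ' : ℕ} (hcop : Nat.Coprime a b) (hβ : β < b)
    (hβ' : β' < b) (h : β * a + γ * b = β' * a + γ' * b) : β = β' ∧ γ = γ' := by
  have h1 : β * a ≡ β' * a [MOD b] := by
    have : (β * a + γ * b) % b = (β' * a + γ' * b) % b := by rw [h]
    simpa [Nat.ModEq] using this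
  have h2 : β ≡ β' [MOD b] := Nat.ModEq.cancel_right_of_coprime (by rwa [Nat.gcd_comm]) h1
  have h3 : β = β' := Nat.ModEq.eq_of_lt_of_lt h2 hβ hβ'
  subst h3
  refine ⟨rfl, Nat.eq_of_mul_eq_mul_right (by omega : 0 < b) (by omega)⟩

variable {k F : Type*} [Field k] [Field F] [Algebra k F]

/-- `x` and `y` generate `F` over `k`, satisfy `f(y) = g(x)`, have their only pole at the rational
point `P`, of coprime orders `a = deg f < b = deg g`, and `H(P)` is generated by `a` and `b`. -/
structure IsPlaneModel (P : Place k F) (a b : ℕ) (f g : k[X]) (x y : F) : Prop where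
  rational : P.IsRational
  pos : 0 < a
  lt : a < b
  coprime : Nat.Coprime a b
  natDegree_f : f.natDegree = a
  natDegree_g : g.natDegree = b
  eqn : aeval y f = aeval x g
  pole_x : HasPoleDivisor x P a
  pole_y : HasPoleDivisor y P b
  semigroup : weierstrassSemigroup P = (AddSubmonoid.closure {a, b} : Set ℕ)
  exists_div : ∀ h : F, ∃ p q : MvPolynomial (Fin 2) k,
    h = MvPolynomial.aeval ![x, y] p / MvPolynomial.aeval ![x, y] q

/-! ### The pole filtration at `P` and its monomial basis -/

namespace IsPlaneModel

variable {P : Place k F} {a b : ℕ} {f g : k[X]} {x y : F} (H : IsPlaneModel P a b f g x y)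
include H

lemma b_pos : 0 < b := H.pos.trans H.lt

lemma v_x : P.v x = exp (a : ℤ) := H.pole_x.v_eq H.pos

lemma v_y : P.v y = exp (b : ℤ) := H.pole_y.v_eq H.b_pos

lemma v_monomial (β γ : ℕ) : P.v (x ^ β * y ^ γ) = exp ((β * a + γ * b : ℕ) : ℤ) := by
  rw [map_mul, map_pow, map_pow, H.v_x, H.v_y, ← exp_nsmul, ← exp_nsmul, ← exp_add]
  simp

lemma monomial_mem (β γ : ℕ) : x ^ β * y ^ γ ∈ regularOutside P :=
  mul_mem (pow_mem H.pole_x.mem_regularOutside _) (pow_mem H.pole_y.mem_regularOutside _)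

lemma aeval_mem (p : MvPolynomial (Fin 2) k) : MvPolynomial.aeval ![x, y] p ∈ regularOutside P := by
  induction p using MvPolynomial.induction_on with
  | C c => simp
  | add p q hp hq => simpa using add_mem hp hq
  | mul_X p i hp =>
    rw [map_mul, MvPolynomial.aeval_X]
    refine mul_mem hp ?_
    fin_cases i
    · exact H.pole_x.mem_regularOutside
    · exact H.pole_y.mem_regularOutside

lemma v_aeval_x {p : k[X]} (hp : p ≠ 0) : P.v (aeval x p) = exp ((p.natDegree * a : ℕ) : ℤ) := by
  rw [Polynomial.valuation_aeval_eq_valuation_X_pow_natDegree_of_one_lt_valuation_X x _ hp,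
    H.v_x, ← exp_nsmul]
  · simp
  · rw [H.v_x, ← exp_zero, exp_lt_exp]; exact_mod_cast H.pos

lemma v_aeval_y {p : k[X]} (hp : p ≠ 0) : P.v (aeval y p) = exp ((p.natDegree * b : ℕ) : ℤ) := by
  rw [Polynomial.valuation_aeval_eq_valuation_X_pow_natDegree_of_one_lt_valuation_X y _ hp,
    H.v_y, ← exp_nsmul]
  · simp
  · rw [H.v_y, ← exp_zero, exp_lt_exp]; exact_mod_cast H.b_pos

/-- If `a = 1` then the curve is a line with coordinate `x` and point at infinity `P`. -/
lemma exists_aeval_eq_of_eq_one (ha : a = 1) {h : F} (hh : h ∈ regularOutside P) :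
    ∃ p : k[X], h = aeval x p := by
  let : Algebra k[X] F := (aeval x : k[X] →ₐ[k] F).toRingHom.toAlgebra
  have hal : ∀ p : k[X], algebraMap k[X] F p = aeval x p := fun p => rfl
  have hinj : Function.Injective (algebraMap k[X] F) := by
    rw [injective_iff_map_eq_zero]
    intro p hp
    by_contra h0
    have := H.v_aeval_x h0
    rw [← hal, hp, map_zero] at this
    exact exp_ne_zero this.symm
  have : FaithfulSMul k[X] F := (faithfulSMul_iff_algebraMap_injective _ _).2 hinj
  have hf1 : f.coeff 1 ≠ 0 := by
    have h1 := H.natDegree_f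
    rw [ha] at h1
    rw [← h1]
    exact leadingCoeff_ne_zero.2 (by rintro rfl; simp at h1)
  -- Here f is linear, so the equation of the curve can be solved for y.
  have hy : y = aeval x (C (f.coeff 1)⁻¹ * (g - C (f.coeff 0))) := by
    have h1 := H.eqn
    rw [eq_X_add_C_of_natDegree_le_one (p := f) (by rw [H.natDegree_f, ha])] at h1
    simp only [map_add, map_mul, aeval_C, aeval_X] at h1
    have h2 : algebraMap k F (f.coeff 1) ≠ 0 := by simpa using hf1
    simp only [map_mul, map_sub, aeval_C, ← h1, map_inv₀]
    field_simp
    ring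
  have hpoly : ∀ p : MvPolynomial (Fin 2) k, ∃ q : k[X],
      MvPolynomial.aeval ![x, y] p = algebraMap k[X] F q := by
    intro p
    refine ⟨MvPolynomial.aeval ![X, C (f.coeff 1)⁻¹ * (g - C (f.coeff 0))] p, ?_⟩
    rw [hal, ← AlgHom.comp_apply, MvPolynomial.comp_aeval]
    congr 2
    ext i
    fin_cases i
    · simp
    · simpa using hy
  have : IsFractionRing k[X] F := by
    apply IsFractionRing.of_field
    intro z
    obtain ⟨p, q, hz⟩ := H.exists_div z
    obtain ⟨p', hp'⟩ := hpoly p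
    obtain ⟨q', hq'⟩ := hpoly q
    exact ⟨p', q', by rw [hz, hp', hq']⟩
  obtain ⟨p, hp⟩ := IsDedekindDomain.HeightOneSpectrum.mem_integers_of_valuation_le_one
    (R := k[X]) F h (fun w => by
      -- A prime of k[x] gives a place where x is regular, hence a place other than `P`. So `h` is
      -- integral at every prime, and therefore a polynomial in x.
      let R : Place k F :=
        { v := w.valuation F
          surj := w.valuation_surjective F
          triv := fun c hc => by
            have e : algebraMap k F c = algebraMap k[X] F (C c) := by rw [hal, aeval_C]
            rw [e]
            refine le_antisymm (w.valuation_le_one _) (not_lt.1 fun hlt => ?_)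
            rw [w.valuation_lt_one_iff_mem] at hlt
            exact w.isPrime.ne_top (Ideal.eq_top_of_isUnit_mem _ hlt
              (isUnit_C.2 (isUnit_iff_ne_zero.2 hc))) }
      refine hh R ?_
      intro hR
      have h1 : R.v x ≤ 1 := by
        have : w.valuation F (algebraMap k[X] F X) ≤ 1 := w.valuation_le_one _
        rwa [hal, aeval_X] at this
      rw [hR, H.v_x, ← exp_zero, exp_le_exp] at h1
      have := H.pos
      omega)
  exact ⟨p, hp.symm⟩

/-- A function without poles which vanishes at `P` is zero. -/
lemma eq_zero_of_v_lt_one {u : F} (hu : u ∈ regularOutside P) (hv : P.v u < 1) : u = 0 := by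
  by_contra h0
  rcases (Nat.succ_le_of_lt H.pos).eq_or_lt with ha | ha
  · obtain ⟨p, rfl⟩ := H.exists_aeval_eq_of_eq_one ha.symm hu
    have hp : p ≠ 0 := by rintro rfl; simp at h0
    rw [H.v_aeval_x hp, ← exp_zero, exp_lt_exp] at hv
    omega
  -- For a > 1 the semigroup has a largest gap N. If `u` vanished at `P` to order e > 0, multiplying
  -- it by a function of pole order N + e would realise N. With a = 1 there is no gap, hence the
  -- separate case.
  · obtain ⟨h1, h2⟩ := frobeniusNumber_iff.1
      (frobeniusNumber_pair H.coprime ha (ha.trans H.lt))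
    set N := a * b - a - b
    obtain ⟨e, he0, he⟩ : ∃ e : ℕ, 0 < e ∧ P.v u = exp (-(e : ℤ)) := by
      have hu0 : P.v u ≠ 0 := by simpa using h0
      have h3 : log (P.v u) < 0 := by rwa [log_lt_iff_lt_exp hu0, exp_zero]
      refine ⟨(-log (P.v u)).toNat, by omega, ?_⟩
      rw [Int.toNat_of_nonneg (by omega), neg_neg, exp_log hu0]
    have h3 : N + e ∈ weierstrassSemigroup P := by
      rw [H.semigroup]; exact h2 _ (by omega)
    obtain ⟨w, hw⟩ := h3
    apply h1
    have h4 : N ∈ weierstrassSemigroup P := by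
      refine ⟨w * u, hasPoleDivisor_of_v_eq (mul_mem hw.mem_regularOutside hu) ?_⟩
      rw [map_mul, hw.v_eq (by omega), he, ← exp_add]
      simp
    rw [H.semigroup] at h4
    exact h4

/-- The functions whose only pole is `P`, of order at most `n`, are spanned by the monomials. -/
lemma mem_span_monomials (n : ℤ) {h : F} (hh : h ∈ regularOutside P) (hv : P.v h ≤ exp n) :
    h ∈ Submodule.span k
      {z | ∃ β γ : ℕ, β < b ∧ ((β * a + γ * b : ℕ) : ℤ) ≤ n ∧ z = x ^ β * y ^ γ} := by
  have base : ∀ (m : ℤ), m < 0 → ∀ {h : F}, h ∈ regularOutside P → P.v h ≤ exp m → h = 0 := by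
    intro m hm h hh hv
    exact H.eq_zero_of_v_lt_one hh (hv.trans_lt (by rw [← exp_zero, exp_lt_exp]; exact hm))
  rcases lt_or_ge n 0 with hn | hn
  · rw [base n hn hh hv]; exact zero_mem _
  lift n to ℕ using hn
  induction n using Nat.strong_induction_on generalizing h with
  | _ n ih =>
  have low : ∀ {h : F}, h ∈ regularOutside P → P.v h < exp (n : ℤ) → h ∈ Submodule.span k
      {z | ∃ β γ : ℕ, β < b ∧ ((β * a + γ * b : ℕ) : ℤ) ≤ n ∧ z = x ^ β * y ^ γ} := by
    intro h hh hv
    rw [lt_exp_iff_le_exp_sub_one] at hv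
    rcases Nat.eq_zero_or_pos n with hn | hn
    · rw [base _ (by omega) hh hv]; exact zero_mem _
    · have e : (n : ℤ) - 1 = ((n - 1 : ℕ) : ℤ) := by omega
      rw [e] at hv
      refine Submodule.span_mono ?_ (ih (n - 1) (by omega) hh hv)
      rintro z ⟨β, γ, h1, h2, h3⟩
      exact ⟨β, γ, h1, by omega, h3⟩
  rcases hv.lt_or_eq with hlt | heq
  · exact low hh hlt
  have hmem : n ∈ weierstrassSemigroup P := ⟨h, hasPoleDivisor_of_v_eq hh heq⟩
  rw [H.semigroup] at hmem
  obtain ⟨β, γ, hβ, rfl⟩ := exists_eq_mul_add_mul_of_mem_closure H.b_pos hmem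
  have hz := H.v_monomial β γ
  set z := x ^ β * y ^ γ with hzdef
  have hz0 : z ≠ 0 := by
    intro h0
    rw [h0, map_zero] at hz
    exact exp_ne_zero hz.symm
  -- `h` and the monomial `z` have the same pole order; as `P` is rational, subtracting the value of
  -- `h / z` at `P` times `z` lowers it.
  obtain ⟨c, hc⟩ := H.rational (h / z) (by rw [map_div₀, heq, hz, div_self exp_ne_zero])
  have e : h = (h - c • z) + c • z := by ring
  rw [e]
  refine add_mem (low (sub_mem hh (Subalgebra.smul_mem _ (H.monomial_mem β γ) c)) ?_)
    (Submodule.smul_mem _ _ (Submodule.subset_span ⟨β, γ, hβ, le_rfl, rfl⟩))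
  have e2 : h - c • z = (h / z - algebraMap k F c) * z := by
    rw [Algebra.smul_def]; field_simp
  rw [e2, map_mul, hz]
  calc _ < 1 * exp ((β * a + γ * b : ℕ) : ℤ) := by
        exact mul_lt_mul_of_pos_right hc exp_pos
    _ = _ := one_mul _

end IsPlaneModel

end PlaneModel

/-! ### The automorphism: its characters on an orbit and the identity `α ^ t = α ^ b` -/

section Twist

variable {k F : Type*} [Field k] [Field F] [Algebra k F]

namespace Place

lemma IsRational.eval_pow {Q : Place k F} (hQ : Q.IsRational) {h : F} (hh : Q.v h ≤ 1) (n : ℕ) :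
    Q.eval (h ^ n) = Q.eval h ^ n := by
  induction n with
  | zero => simpa using Q.eval_algebraMap (1 : k)
  | succ n ih =>
    rw [pow_succ, hQ.eval_mul (by rw [map_pow]; exact pow_le_one₀ zero_le hh) hh, ih, pow_succ]

lemma v_aeval_le_one (Q : Place k F) {h : F} (hh : Q.v h ≤ 1) (p : k[X]) :
    Q.v (aeval h p) ≤ 1 := by
  rw [aeval_eq_sum_range]
  refine Q.v.map_sum_le fun i _ => ?_
  rw [Algebra.smul_def, map_mul, map_pow]
  exact mul_le_one' (Q.v_algebraMap_le _) (pow_le_one₀ zero_le hh)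

lemma IsRational.eval_aeval {Q : Place k F} (hQ : Q.IsRational) {h : F} (hh : Q.v h ≤ 1)
    (p : k[X]) : Q.eval (aeval h p) = p.eval (Q.eval h) := by
  induction p using Polynomial.induction_on' with
  | add p q hp hq =>
    rw [map_add, hQ.eval_add (Q.v_aeval_le_one hh p) (Q.v_aeval_le_one hh q), hp, hq,
      Polynomial.eval_add]
  | monomial n c =>
    rw [aeval_monomial, hQ.eval_mul (Q.v_algebraMap_le c)
      (by rw [map_pow]; exact pow_le_one₀ zero_le hh), hQ.eval_pow hh, eval_algebraMap,
      eval_monomial]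

end Place

lemma sigma_pow_apply {σ : F ≃ₐ[k] F} {z : F} {c : k} (hz : σ z = algebraMap k F c * z) (j : ℕ) :
    (σ ^ j) z = algebraMap k F (c ^ j) * z := by
  induction j with
  | zero => simp
  | succ j ih =>
    rw [pow_succ, AlgEquiv.mul_apply, hz, map_mul, AlgEquiv.commutes, ih, pow_succ, map_mul]
    ring

lemma sigma_aeval {σ : F ≃ₐ[k] F} {z : F} {c : k} (hz : σ z = algebraMap k F c * z) (p : k[X]) :
    σ (aeval z p) = aeval z (p.comp (C c * X)) := by
  rw [aeval_comp, map_mul, aeval_C, aeval_X, ← hz]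
  exact (aeval_algHom_apply (σ : F →ₐ[k] F) z p).symm

/-- If `w` has simple zeros exactly at the points of `S`, then it divides the functions that vanish
on `S`. -/
lemma exists_eq_mul_of_vanishing {P : Place k F} {S : Set (Place k F)}
    (hS : ∀ R ∈ S, R.IsRational ∧ R ≠ P) {w : F} (hw0 : w ≠ 0)
    (hw : ∀ R ∈ S, R.v w = exp (-1 : ℤ)) (hw' : ∀ R ∉ S, R ≠ P → R.v w = 1)
    {h : F} (hh : h ∈ regularOutside P) (hv : ∀ R ∈ S, R.eval h = 0) :
    ∃ h' ∈ regularOutside P, h = w * h' := by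
  refine ⟨h / w, fun R hR => ?_, by field_simp⟩
  rw [map_div₀]
  by_cases hRS : R ∈ S
  · have h1 := ((hS R hRS).1.eval_eq_zero_iff (hh R hR)).1 (hv R hRS)
    rw [lt_one_iff_le_exp_neg_one, ← hw R hRS] at h1
    exact div_le_one_of_le₀ h1 zero_le
  · rw [hw' R hRS hR, div_one]
    exact hh R hR

lemma act_pow_mem {σ : F ≃ₐ[k] F} {P Q : Place k F}
    (hQ : Place.orbit σ Q ⊆ ratPointsExcept P) (j : ℕ) :
    (Place.act (σ ^ j) Q).IsRational ∧ Place.act (σ ^ j) Q ≠ P :=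
  hQ (Place.act_mem_orbit σ Q j)

namespace IsPlaneModel

variable {P : Place k F} {a b : ℕ} {f g : k[X]} {x y : F} (H : IsPlaneModel P a b f g x y)
include H

lemma y_ne_zero : y ≠ 0 := H.pole_y.1

lemma aeval_x_injective {p : k[X]} (h : aeval x p = 0) : p = 0 := by
  by_contra hp
  have := H.v_aeval_x hp
  rw [h, map_zero] at this
  exact exp_ne_zero this.symm

lemma aeval_y_injective {p : k[X]} (h : aeval y p = 0) : p = 0 := by
  by_contra hp
  have := H.v_aeval_y hp
  rw [h, map_zero] at this
  exact exp_ne_zero this.symm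

/-- A polynomial of degree less than `b` in `x` which is a polynomial in `y` is constant. -/
lemma natDegree_eq_zero_of_aeval_eq {p q : k[X]} (hp : p.natDegree < b)
    (h : aeval x p = aeval y q) : p.natDegree = 0 ∧ q.natDegree = 0 := by
  by_cases hp0 : p = 0
  · subst hp0
    rw [map_zero] at h
    rw [H.aeval_y_injective h.symm]
    simp
  by_cases hq0 : q = 0
  · subst hq0
    rw [map_zero] at h
    exact absurd (H.aeval_x_injective h) hp0
  have h1 : p.natDegree * a = q.natDegree * b := by
    have := H.v_aeval_x hp0
    rw [h, H.v_aeval_y hq0, exp_inj] at this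
    exact_mod_cast this.symm
  have h2 := mul_add_mul_injective (γ := 0) (γ' := q.natDegree) H.coprime hp H.b_pos (by omega)
  exact ⟨h2.1, h2.2.symm⟩

section Automorphism

variable {α : k} {t : ℕ} {σ : F ≃ₐ[k] F} (hσx : σ x = algebraMap k F α * x)
  (hσy : σ y = algebraMap k F (α ^ t) * y)
include hσx hσy

/-- The equation `f(α ^ t y) = g(α x)` is a multiple of `f(y) = g(x)`. -/
lemma twist_coeff : (∀ n, 0 < n → g.coeff n * α ^ n = α ^ b * g.coeff n) ∧
    (∀ n, 0 < n → f.coeff n * (α ^ t) ^ n = α ^ b * f.coeff n) ∧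
    g.coeff 0 - α ^ b * g.coeff 0 = f.coeff 0 - α ^ b * f.coeff 0 := by
  -- Subtracting `α ^ b` times the equation cancels the coefficient of x^b, so `p` has degree below
  -- `b` in x and, being equal to a polynomial in y, must be constant.
  set p := g.comp (C α * X) - C (α ^ b) * g with hp
  set q := f.comp (C (α ^ t) * X) - C (α ^ b) * f with hq
  have hpc : ∀ n, p.coeff n = g.coeff n * α ^ n - α ^ b * g.coeff n := fun n => by
    rw [hp, coeff_sub, comp_C_mul_X_coeff, coeff_C_mul]
  have hqc : ∀ n, q.coeff n = f.coeff n * (α ^ t) ^ n - α ^ b * f.coeff n := fun n => by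
    rw [hq, coeff_sub, comp_C_mul_X_coeff, coeff_C_mul]
  have hpq : aeval x p = aeval y q := by
    rw [hp, hq, map_sub, map_sub, map_mul, map_mul, ← sigma_aeval hσx, ← sigma_aeval hσy, H.eqn,
      aeval_C, aeval_C]
  have hpd : p.natDegree < b := by
    have h1 : p.natDegree ≤ b - 1 := by
      rw [natDegree_le_iff_coeff_eq_zero]
      intro n hn
      rcases (show b ≤ n by omega).eq_or_lt with rfl | hn'
      · rw [hpc]; ring
      · rw [hpc, coeff_eq_zero_of_natDegree_lt (by rw [H.natDegree_g]; exact hn')]; ring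
    have := H.b_pos
    omega
  obtain ⟨h1, h2⟩ := H.natDegree_eq_zero_of_aeval_eq hpd hpq
  refine ⟨fun n hn => ?_, fun n hn => ?_, ?_⟩
  · rw [← sub_eq_zero, ← hpc]
    exact coeff_eq_zero_of_natDegree_lt (by omega)
  · rw [← sub_eq_zero, ← hqc]
    exact coeff_eq_zero_of_natDegree_lt (by omega)
  · rw [eq_C_of_natDegree_eq_zero h1, eq_C_of_natDegree_eq_zero h2, aeval_C, aeval_C] at hpq
    have h3 := (algebraMap k F).injective hpq
    rw [hpc, hqc] at h3
    simpa using h3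

lemma eval_act_monomial {Q : Place k F} (hQ : Q.IsRational) (hQP : Q ≠ P) (j β γ : ℕ) :
    (Place.act (σ ^ j) Q).eval (x ^ β * y ^ γ) =
      (α ^ (β + t * γ)) ^ j * (Q.eval x ^ β * Q.eval y ^ γ) := by
  have hx := H.pole_x.mem_regularOutside Q hQP
  have hy := H.pole_y.mem_regularOutside Q hQP
  have e : (σ ^ j) (x ^ β * y ^ γ) =
      algebraMap k F ((α ^ (β + t * γ)) ^ j) * (x ^ β * y ^ γ) := by
    rw [map_mul, map_pow, map_pow, sigma_pow_apply hσx, sigma_pow_apply hσy]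
    simp only [map_pow]
    ring
  rw [Place.act_eval, e, hQ.eval_mul (Q.v_algebraMap_le _) (H.monomial_mem β γ Q hQP),
    Place.eval_algebraMap, hQ.eval_mul, hQ.eval_pow hx, hQ.eval_pow hy]
  · rw [map_pow]; exact pow_le_one₀ zero_le hx
  · rw [map_pow]; exact pow_le_one₀ zero_le hy

section Orbit

variable {Q : Place k F} (hQ : Place.orbit σ Q ⊆ ratPointsExcept P)
  (hQx : Q.eval x ≠ 0) (hQy : Q.eval y ≠ 0) {ρ : ℕ} {m : k[X]}
  (hmz : ∀ R : Place k F, (R ∈ Place.orbit σ Q → R.zeroOrder (aeval y m) = 1) ∧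
    (R ∉ Place.orbit σ Q → R.zeroOrder (aeval y m) = 0))
  (hmp : HasPoleDivisor (aeval y m) P (ρ * b))
include hQ

include hmz hmp

omit hσx hσy hQ in
lemma natDegree_orbit_poly : m ≠ 0 ∧ m.natDegree = ρ ∧
    P.v (aeval y m) = exp ((ρ * b : ℕ) : ℤ) := by
  have hm0 : m ≠ 0 := by
    rintro rfl
    exact hmp.1 (by simp)
  have h1 := H.v_aeval_y hm0
  have h2 := hmp.2.1
  rw [Place.poleOrder_eq, h1, log_exp, Int.toNat_natCast] at h2
  have h3 := Nat.eq_of_mul_eq_mul_right H.b_pos h2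
  exact ⟨hm0, h3, by rw [h1, h2]⟩

omit H hσx hσy in
lemma exists_eq_orbit_poly_mul {h : F} (hh : h ∈ regularOutside P)
    (hv : ∀ R ∈ Place.orbit σ Q, R.eval h = 0) :
    ∃ h' ∈ regularOutside P, h = aeval y m * h' :=
  exists_eq_mul_of_vanishing hQ hmp.1 (fun R hR => Place.v_eq_of_zeroOrder_eq_one ((hmz R).1 hR))
    (fun R hR hRP => Place.v_eq_one_of_orders hmp.1 ((hmz R).2 hR) (hmp.2.2 R hRP)) hh hv

omit hσx hmp in
lemma eval_orbit_poly (j : ℕ) : m.eval ((α ^ t) ^ j * Q.eval y) = 0 := by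
  obtain ⟨hr, hP⟩ := act_pow_mem hQ j
  have hR : (Place.act (σ ^ j) Q).eval y = (α ^ t) ^ j * Q.eval y := by
    rw [Place.act_eval, sigma_pow_apply hσy]
    obtain ⟨hr, hP⟩ := act_pow_mem hQ 0
    rw [pow_zero, Place.act_one] at hr hP
    rw [hr.eval_mul (Q.v_algebraMap_le _) (H.pole_y.mem_regularOutside Q hP),
      Place.eval_algebraMap]
  have hy := H.pole_y.mem_regularOutside _ hP
  rw [← hR, ← hr.eval_aeval hy, hr.eval_eq_zero_iff (Place.v_aeval_le_one _ hy m),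
    Place.v_eq_of_zeroOrder_eq_one ((hmz _).1 (Place.act_mem_orbit σ Q j)), ← exp_zero, exp_lt_exp]
  norm_num

include hQx hQy

/-- The monomials `x ^ β y ^ γ` with `β < b` and `γ < ρ` give distinct characters on the orbit. -/
lemma exponent_injective {β γ β' γ' : ℕ} (hβ : β < b) (hβ' : β' < b) (hγ : γ < ρ) (hγ' : γ' < ρ)
    (h : α ^ (β + t * γ) = α ^ (β' + t * γ')) : β = β' ∧ γ = γ' := by
  obtain ⟨-, -, hv⟩ := H.natDegree_orbit_poly hmz hmp
  obtain ⟨hr, hP⟩ := act_pow_mem hQ 0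
  rw [pow_zero, Place.act_one] at hr hP
  by_contra hne
  set c := Q.eval x ^ β * Q.eval y ^ γ with hc
  set c' := Q.eval x ^ β' * Q.eval y ^ γ' with hc'
  have hc0 : c ≠ 0 := mul_ne_zero (pow_ne_zero _ hQx) (pow_ne_zero _ hQy)
  have hc0' : c' ≠ 0 := mul_ne_zero (pow_ne_zero _ hQx) (pow_ne_zero _ hQy)
  -- The scalars make `h₁ + h₂` vanish at `Q`; both terms transform by the same character, so the
  -- sum vanishes on the whole orbit.
  set h₁ := algebraMap k F c' * (x ^ β * y ^ γ) with hh₁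
  set h₂ := algebraMap k F (-c) * (x ^ β' * y ^ γ') with hh₂
  have hr₁ : h₁ ∈ regularOutside P :=
    mul_mem (Subalgebra.algebraMap_mem _ _) (H.monomial_mem _ _)
  have hr₂ : h₂ ∈ regularOutside P :=
    mul_mem (Subalgebra.algebraMap_mem _ _) (H.monomial_mem _ _)
  have hv₁ : P.v h₁ = exp ((β * a + γ * b : ℕ) : ℤ) := by
    rw [hh₁, map_mul, P.triv _ hc0', H.v_monomial, one_mul]
  have hv₂ : P.v h₂ = exp ((β' * a + γ' * b : ℕ) : ℤ) := by
    rw [hh₂, map_mul, P.triv _ (neg_ne_zero.2 hc0), H.v_monomial, one_mul]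
  have hvne : P.v h₁ ≠ P.v h₂ := by
    rw [hv₁, hv₂]
    intro h3
    rw [exp_inj] at h3
    exact hne (mul_add_mul_injective H.coprime hβ hβ' (by exact_mod_cast h3))
  -- The two pole orders differ, so the sum has the larger one, whose exponent of y is below `ρ`.
  obtain ⟨β₀, γ₀, hβ₀, hγ₀, hv₀⟩ : ∃ β₀ γ₀, β₀ < b ∧ γ₀ < ρ ∧
      P.v (h₁ + h₂) = exp ((β₀ * a + γ₀ * b : ℕ) : ℤ) := by
    rw [P.v.map_add_of_distinct_val hvne]
    rcases max_choice (P.v h₁) (P.v h₂) with h3 | h3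
    · exact ⟨β, γ, hβ, hγ, h3.trans hv₁⟩
    · exact ⟨β', γ', hβ', hγ', h3.trans hv₂⟩
  obtain ⟨h', hh', heq⟩ := exists_eq_orbit_poly_mul hQ hmz hmp (add_mem hr₁ hr₂) (by
    rintro R ⟨j, rfl⟩
    obtain ⟨hRr, hRP⟩ := act_pow_mem hQ j
    rw [hRr.eval_add (hr₁ _ hRP) (hr₂ _ hRP), hh₁, hh₂,
      hRr.eval_mul (Place.v_algebraMap_le _ _) (H.monomial_mem _ _ _ hRP),
      hRr.eval_mul (Place.v_algebraMap_le _ _) (H.monomial_mem _ _ _ hRP),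
      Place.eval_algebraMap, Place.eval_algebraMap, H.eval_act_monomial hσx hσy hr hP,
      H.eval_act_monomial hσx hσy hr hP, h]
    ring)
  have h0' : h' ≠ 0 := by
    rintro rfl
    rw [heq, mul_zero, map_zero] at hv₀
    exact exp_ne_zero hv₀.symm
  have hmem : P.poleOrder h' ∈ weierstrassSemigroup P := ⟨h', hasPoleDivisor_poleOrder h0' hh'⟩
  have hn := hasPoleDivisor_poleOrder h0' hh'
  obtain ⟨n, hn⟩ : ∃ n : ℕ, P.v h' = exp (n : ℤ) ∧ n ∈ weierstrassSemigroup P := by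
    refine ⟨P.poleOrder h', ?_, hmem⟩
    rcases Nat.eq_zero_or_pos (P.poleOrder h') with h4 | h4
    · rw [h4]
      rw [Place.poleOrder_eq_zero_iff] at h4
      rcases h4.lt_or_eq with h5 | h5
      · exact absurd (H.eq_zero_of_v_lt_one hh' h5) h0'
      · simpa using h5
    · exact hn.v_eq h4
  obtain ⟨hvn, hn⟩ := hn
  rw [H.semigroup] at hn
  obtain ⟨β₁, γ₁, hβ₁, rfl⟩ := exists_eq_mul_add_mul_of_mem_closure H.b_pos hn
  rw [heq, map_mul, hv, hvn, ← exp_add, exp_inj] at hv₀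
  -- The factor `aeval y m` contributes `ρ * b` to the pole order, so uniqueness of the
  -- representation gives γ₀ = γ₁ + ρ ≥ ρ, a contradiction.
  have h5 : β₁ * a + (γ₁ + ρ) * b = β₀ * a + γ₀ * b := by
    have : ρ * b + (β₁ * a + γ₁ * b) = β₀ * a + γ₀ * b := by exact_mod_cast hv₀
    rw [← this]; ring
  have h6 := mul_add_mul_injective H.coprime hβ₁ hβ₀ h5
  omega

omit hσx hQx in
-- The values of y along the orbit are roots of `m`; as y(Q) ≠ 0, they are as many as the order of
-- `α ^ t`, while `m` has degree `ρ`.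
lemma orderOf_le : 0 < ρ ∧ orderOf (α ^ t) ≤ ρ := by
  classical
  obtain ⟨hm0, hd, -⟩ := H.natDegree_orbit_poly hmz hmp
  have hroot : ∀ j, (α ^ t) ^ j * Q.eval y ∈ m.roots.toFinset := fun j => by
    rw [Multiset.mem_toFinset, mem_roots hm0]
    exact H.eval_orbit_poly hσy hQ hmz j
  have hcard : m.roots.toFinset.card ≤ ρ :=
    (Multiset.toFinset_card_le _).trans (hd ▸ m.card_roots')
  refine ⟨(Finset.card_pos.2 ⟨_, hroot 0⟩).trans_le hcard, le_trans ?_ hcard⟩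
  rw [← Finset.card_range (orderOf (α ^ t))]
  refine Finset.card_le_card_of_injOn (fun j => (α ^ t) ^ j * Q.eval y) (fun j _ => hroot j) ?_
  intro i hi j hj hij
  have h1 : (α ^ t) ^ i = (α ^ t) ^ j := mul_right_cancel₀ hQy hij
  exact pow_injOn_Iio_orderOf (by simpa using hi) (by simpa using hj) h1

/-- If the order d of `α ^ t` were below `ρ`, then 1 and y^d would give the same character. -/
lemma pow_orbit_length [Finite k] (hα : α ≠ 0) : (α ^ t) ^ ρ = 1 := by
  obtain ⟨-, h1⟩ := H.orderOf_le hσy hQ hQy hmz hmp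
  have h2 : 0 < orderOf (α ^ t) := by
    rw [orderOf_pos_iff, isOfFinOrder_iff_pow_eq_one]
    have := Fintype.ofFinite k
    exact ⟨Fintype.card k - 1, by have := Fintype.one_lt_card (α := k); omega,
      FiniteField.pow_card_sub_one_eq_one _ (pow_ne_zero _ hα)⟩
  rcases h1.lt_or_eq with h3 | h3
  · have := H.exponent_injective hσx hσy hQ hQx hQy hmz hmp H.b_pos H.b_pos h3 (h2.trans h3)
      (by rw [pow_add, pow_add, pow_mul, pow_mul, pow_orderOf_eq_one]; simp)
    omega
  · rw [← h3, pow_orderOf_eq_one]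

/-- The scalar by which `σ` acts on `y` is `α ^ b`. -/
lemma pow_t_eq_pow_b [Finite k] (hα : α ≠ 0) : α ^ t = α ^ b := by
  obtain ⟨hg, hf, h0⟩ := H.twist_coeff hσx hσy
  have hρ := (H.orderOf_le hσy hQ hQy hmz hmp).1
  have hinj := fun {β γ β' γ' : ℕ} => H.exponent_injective hσx hσy hQ hQx hQy hmz hmp
    (β := β) (γ := γ) (β' := β') (γ' := γ')
  by_cases hf1 : f.coeff 1 = 0
  swap
  · have := hf 1 one_pos
    rw [pow_one, mul_comm] at this
    exact mul_right_cancel₀ hf1 this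
  -- Different constant terms force `α ^ b = 1`. Then x^(t mod b) and y have the same character,
  -- which is impossible unless `ρ = 1`, and in that case `α ^ t = 1`.
  by_cases hfg : g.coeff 0 = f.coeff 0
  swap
  · have hb : α ^ b = 1 := by
      have : (g.coeff 0 - f.coeff 0) * (1 - α ^ b) = 0 := by linear_combination h0
      rcases mul_eq_zero.1 this with h | h
      · exact absurd (sub_eq_zero.1 h) hfg
      · exact (sub_eq_zero.1 h).symm
    rw [hb]
    have hmod : α ^ t = α ^ (t % b) := by
      conv_lhs => rw [← Nat.mod_add_div t b, pow_add, pow_mul, hb, one_pow, mul_one]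
    rcases (Nat.succ_le_of_lt hρ).eq_or_lt with h1 | h1
    · have := H.pow_orbit_length hσx hσy hQ hQx hQy hmz hmp hα
      rwa [← h1, Nat.succ_eq_add_one, zero_add, pow_one] at this
    · have := hinj (β := t % b) (γ := 0) (β' := 0) (γ' := 1) (Nat.mod_lt _ H.b_pos) H.b_pos hρ h1
        (by simpa using hmod.symm)
      omega
  exfalso
  have ha : 1 < a := by
    by_contra ha
    have ha1 : a = 1 := by have := H.pos; omega
    have h1 := H.natDegree_f
    rw [ha1] at h1
    rw [← h1] at hf1
    rw [leadingCoeff_eq_zero.1 hf1] at h1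
    simp at h1
  -- A middle term of g would give `α ^ (b - n) = 1`, so that x^(b-n) and 1 would have the same
  -- character.
  have hgn : ∀ n, 0 < n → n < b → g.coeff n = 0 := by
    intro n hn hnb
    by_contra hgn
    have h1 := hg n hn
    rw [mul_comm] at h1
    have h2 := mul_right_cancel₀ hgn h1
    have h3 : α ^ (b - n) = 1 := by
      apply mul_left_cancel₀ (pow_ne_zero n hα)
      rw [← pow_add, Nat.add_sub_cancel' hnb.le, h2, mul_one]
    have := hinj (β := b - n) (γ := 0) (β' := 0) (γ' := 0) (by omega) H.b_pos hρ hρ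
      (by simpa using h3)
    omega
  have hgb : g.leadingCoeff ≠ 0 := by
    rw [leadingCoeff_ne_zero]
    rintro rfl
    have := H.natDegree_g
    have := H.b_pos
    simp at *
    omega
  have hgx : g = C g.leadingCoeff * X ^ b + C (g.coeff 0) := by
    ext n
    rw [coeff_add, coeff_C_mul_X_pow, coeff_C]
    rcases Nat.eq_zero_or_pos n with rfl | hn
    · simp [H.b_pos.ne]
    rcases lt_trichotomy n b with h | h | h
    · simp [hgn n hn h, h.ne, hn.ne']
    · subst h
      simp [hn.ne', leadingCoeff, H.natDegree_g]
    · simp [coeff_eq_zero_of_natDegree_lt (H.natDegree_g.trans_lt h), h.ne', hn.ne']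
  have hfx : f = X ^ 2 * f.divX.divX + C (f.coeff 0) := by
    have h1 := f.divX_mul_X_add
    have h2 := f.divX.divX_mul_X_add
    rw [coeff_divX, zero_add, hf1, C_0, add_zero] at h2
    rw [← h2] at h1
    rw [pow_two]
    linear_combination -h1
  have hrel : y ^ 2 * aeval y f.divX.divX = algebraMap k F g.leadingCoeff * x ^ b := by
    have h1 := H.eqn
    rw [hfx, hgx, hfg] at h1
    simpa only [map_add, map_mul, map_pow, aeval_X, aeval_C, add_left_inj] using h1
  have hy0 := H.y_ne_zero
  have hlt := H.lt
  -- The relation y² q(y) = c x^b makes c times the square of this function equal to x^(b-2) q(y),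
  -- so it is regular outside `P`; its pole order (b-1)a - b is the Frobenius number.
  have hreg : x ^ (b - 1) / y ∈ regularOutside P := by
    intro R hR
    have hx' := H.pole_x.mem_regularOutside R hR
    have hy' := H.pole_y.mem_regularOutside R hR
    have h1 : (x ^ (b - 1) / y) ^ 2 * algebraMap k F g.leadingCoeff =
        x ^ (b - 2) * aeval y f.divX.divX := by
      obtain ⟨d, rfl⟩ : ∃ d, b = d + 2 := ⟨b - 2, by omega⟩
      simp only [Nat.add_sub_cancel, show d + 2 - 1 = d + 1 by omega]
      field_simp
      linear_combination (-x ^ d) * hrel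
    have h2 := congrArg R.v h1
    rw [map_mul, map_pow, R.triv _ hgb, mul_one] at h2
    have h3 : R.v (x ^ (b - 1) / y) ^ 2 ≤ 1 := by
      rw [h2, map_mul, map_pow]
      exact mul_le_one' (pow_le_one₀ zero_le hx') (R.v_aeval_le_one hy' _)
    exact (pow_le_one_iff_of_nonneg zero_le two_ne_zero).1 h3
  have hle : a + b ≤ a * b := by nlinarith
  have hmem : a * b - a - b ∈ weierstrassSemigroup P := by
    refine ⟨_, hasPoleDivisor_of_v_eq hreg ?_⟩
    rw [map_div₀, map_pow, H.v_x, H.v_y, ← exp_nsmul, ← exp_sub, exp_inj]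
    rw [nsmul_eq_mul, Nat.cast_sub (by omega), Nat.cast_sub (by omega), Nat.cast_sub (by omega)]
    push_cast
    ring
  rw [H.semigroup] at hmem
  exact (frobeniusNumber_iff.1 (frobeniusNumber_pair H.coprime ha (ha.trans hlt))).1 hmem

end Orbit

end Automorphism

end IsPlaneModel

end Twist

section TriangularBasis

variable {k : Type*} [Field k] {n : ℕ}

/-! ### Triangular Groebner bases -/

lemma potLT_of_forall {p : Fin n → k[X]} {i : Fin n} (h : ∀ j < i, p j = 0) :
    potLT p i = monomial (p i).natDegree (p i).leadingCoeff := if_pos h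

lemma potLT_of_ne_zero {p : Fin n → k[X]} {i j : Fin n} (hj : j < i) (h : p j ≠ 0) :
    potLT p i = 0 := if_neg fun H => h (H j hj)

/-- In column `i` only the leading term of `G i` survives: earlier generators lead in their own,
nonzero, diagonal position, and later ones are zero there. -/
lemma IsTriangularGroebnerBasis.potLT_dvd {M : Set (Fin n → k[X])} {G : Fin n → Fin n → k[X]}
    (hG : IsTriangularGroebnerBasis M G) {i : Fin n} (hi : ∀ j < i, G j j ≠ 0)
    {p : Fin n → k[X]} (hp : p ∈ M) : potLT (G i) i ∣ potLT p i := by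
  have h1 : potLT p ∈ Submodule.span k[X] (Set.range fun i => potLT (G i)) := by
    rw [hG.2.1]
    exact Submodule.subset_span ⟨p, hp, rfl⟩
  obtain ⟨c, hc⟩ := (Submodule.mem_span_range_iff_exists_fun _).1 h1
  refine ⟨c i, ?_⟩
  rw [← hc, Finset.sum_apply, Finset.sum_eq_single i]
  · simp [mul_comm]
  · intro j _ hji
    rw [Pi.smul_apply]
    rcases lt_or_gt_of_ne hji with h | h
    · rw [potLT_of_ne_zero h (hi j h), smul_zero]
    · rw [potLT_of_forall fun l hl => hG.2.2 j l (hl.trans h), hG.2.2 j i h]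
      simp
  · simp

lemma IsTriangularGroebnerBasis.diag_ne_zero {M : Set (Fin n → k[X])} {G : Fin n → Fin n → k[X]}
    (hG : IsTriangularGroebnerBasis M G)
    (hM : ∀ i, ∃ p ∈ M, (∀ j < i, p j = 0) ∧ p i ≠ 0) (i : Fin n) : G i i ≠ 0 := by
  induction i using WellFoundedLT.induction with
  | _ i ih =>
  obtain ⟨p, hp, hpl, hpi⟩ := hM i
  have h1 := hG.potLT_dvd ih hp
  rintro h0
  rw [potLT_of_forall fun l hl => hG.2.2 i l hl, h0, potLT_of_forall hpl] at h1
  simp [hpi] at h1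

/-- Division with remainder by `G i`: a nonzero remainder would be the leading component of an
element of `M` and have degree below that of `G i i`. -/
lemma IsTriangularGroebnerBasis.diag_dvd {M : Submodule k[X] (Fin n → k[X])}
    {G : Fin n → Fin n → k[X]} (hG : IsTriangularGroebnerBasis (M : Set (Fin n → k[X])) G)
    (hM : ∀ i, ∃ p ∈ M, (∀ j < i, p j = 0) ∧ p i ≠ 0) {i : Fin n} {p : Fin n → k[X]}
    (hp : p ∈ M) (hpl : ∀ j < i, p j = 0) : G i i ∣ p i := by
  have hd := hG.diag_ne_zero hM
  rw [← EuclideanDomain.mod_eq_zero]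
  by_contra hr
  set r := p i % G i i with hrdef
  set p' : Fin n → k[X] := p - (p i / G i i) • G i with hp'
  have hp'M : p' ∈ M := sub_mem hp (M.smul_mem _ (hG.1 i))
  have hp'l : ∀ j < i, p' j = 0 := fun j hj => by
    simp [hp', hpl j hj, hG.2.2 i j hj]
  have hp'i : p' i = r := by
    rw [hp', hrdef, EuclideanDomain.mod_eq_sub_mul_div, Pi.sub_apply, Pi.smul_apply, smul_eq_mul,
      mul_comm]
  have h1 := hG.potLT_dvd (i := i) (fun j _ => hd j) hp'M
  rw [potLT_of_forall fun l hl => hG.2.2 i l hl, potLT_of_forall hp'l, hp'i] at h1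
  have h2 := natDegree_le_of_dvd h1 (by simpa using hr)
  rw [natDegree_monomial_eq _ (leadingCoeff_ne_zero.2 (hd i)),
    natDegree_monomial_eq _ (leadingCoeff_ne_zero.2 hr)] at h2
  have h3 : r.degree < (G i i).degree := EuclideanDomain.mod_lt _ (hd i)
  exact absurd (natDegree_lt_natDegree hr h3) (by omega)

end TriangularBasis

section CodeModule

variable {k F : Type*} [Field k] [Field F] [Algebra k F]

/-! ### The module of a one-point code -/

/-- The generating polynomial of the values of `h` along the orbit of `Q`. -/
noncomputable def valuePoly (σ : F ≃ₐ[k] F) (Q : Place k F) (h : F) : k[X] :=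
  ∑ j ∈ Finset.range (Place.orbit σ Q).ncard, C ((Place.act (σ ^ j) Q).eval h) * X ^ j

lemma orbitPoly_eq_valuePoly {σ : F ≃ₐ[k] F} {D : Set (Place k F)} {Q : Place k F}
    (hQ : Place.orbit σ Q ⊆ D) {c : D → k} {h : F} (hc : ∀ R : D, c R = R.1.eval h) :
    orbitPoly σ D Q c = valuePoly σ Q h := by
  refine Finset.sum_congr rfl fun j _ => ?_
  have hm := hQ (Place.act_mem_orbit σ Q j)
  have := Subtype.val_injective.extend_apply c (0 : Place k F → k) ⟨_, hm⟩
  simp only at this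
  rw [this, hc]

lemma mem_codeModule {σ : F ≃ₐ[k] F} {P : Place k F} {n : ℕ} {Q : Fin n → Place k F}
    (hQ : ∀ i, Place.orbit σ (Q i) ⊆ ratPointsExcept P) {lam : ℕ} {p : Fin n → k[X]} :
    p ∈ codeModule σ (ratPointsExcept P) Q (onePointCode P lam) ↔
      ∃ h ∈ regularOutside P, P.v h ≤ exp (lam : ℤ) ∧
        ∀ i, (X ^ (Place.orbit σ (Q i)).ncard - 1 : k[X]) ∣ p i - valuePoly σ (Q i) h := by
  constructor
  · rintro ⟨c, ⟨h, hh, hc⟩, hp⟩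
    obtain ⟨h1, h2⟩ := mem_riemannRochSpace_single.1 hh
    exact ⟨h, h1, h2, fun i => by rw [← orbitPoly_eq_valuePoly (hQ i) hc]; exact hp i⟩
  · rintro ⟨h, h1, h2, hp⟩
    refine ⟨fun R => R.1.eval h, ⟨h, mem_riemannRochSpace_single.2 ⟨h1, h2⟩, fun _ => rfl⟩,
      fun i => ?_⟩
    rw [orbitPoly_eq_valuePoly (hQ i) fun _ => rfl]
    exact hp i

section ValuePoly

variable {σ : F ≃ₐ[k] F} {P Q : Place k F} (hQ : Place.orbit σ Q ⊆ ratPointsExcept P)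
include hQ

lemma valuePoly_add {h₁ h₂ : F} (hh₁ : h₁ ∈ regularOutside P) (hh₂ : h₂ ∈ regularOutside P) :
    valuePoly σ Q (h₁ + h₂) = valuePoly σ Q h₁ + valuePoly σ Q h₂ := by
  rw [valuePoly, valuePoly, valuePoly, ← Finset.sum_add_distrib]
  refine Finset.sum_congr rfl fun j _ => ?_
  obtain ⟨hr, hP⟩ := act_pow_mem hQ j
  rw [hr.eval_add (hh₁ _ hP) (hh₂ _ hP), C_add, add_mul]

lemma valuePoly_smul {h : F} (hh : h ∈ regularOutside P) (c : k) :
    valuePoly σ Q (algebraMap k F c * h) = C c * valuePoly σ Q h := by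
  rw [valuePoly, valuePoly, Finset.mul_sum]
  refine Finset.sum_congr rfl fun j _ => ?_
  obtain ⟨hr, hP⟩ := act_pow_mem hQ j
  rw [hr.eval_mul (Place.v_algebraMap_le _ _) (hh _ hP), Place.eval_algebraMap, C_mul, mul_assoc]

omit hQ in
lemma valuePoly_zero : valuePoly σ Q 0 = 0 := by
  refine Finset.sum_eq_zero fun j _ => ?_
  have := (Place.act (σ ^ j) Q).eval_algebraMap (0 : k)
  rw [map_zero] at this
  rw [this, C_0, zero_mul]

omit hQ in
/-- The cyclic shift of the values of `h` is given by the values of `σ⁻¹ h`. -/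
lemma dvd_X_mul_valuePoly_sub (hper : Q ∈ Function.periodicPts (Place.act σ)) (h : F) :
    (X ^ (Place.orbit σ Q).ncard - 1 : k[X]) ∣
      X * valuePoly σ Q h - valuePoly σ Q (σ.symm h) := by
  have hpos := Function.minimalPeriod_pos_of_mem_periodicPts hper
  have hclose : Place.act (σ ^ (Place.orbit σ Q).ncard) Q = Q := by
    rw [Place.act_pow, Place.ncard_orbit σ Q hper, Function.iterate_minimalPeriod]
  rw [← Place.ncard_orbit σ Q hper] at hpos
  unfold valuePoly
  obtain ⟨m, hm⟩ : ∃ m, (Place.orbit σ Q).ncard = m + 1 := ⟨_, (Nat.succ_pred hpos.ne').symm⟩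
  rw [hm] at hclose ⊢
  have hstep : ∀ j, (Place.act (σ ^ (j + 1)) Q).eval (σ.symm h) = (Place.act (σ ^ j) Q).eval h := by
    intro j
    rw [pow_succ, Place.act_mul, Place.act_eval, AlgEquiv.apply_symm_apply]
  have h0 : (Place.act (σ ^ 0) Q).eval (σ.symm h) = (Place.act (σ ^ m) Q).eval h := by
    rw [← hstep, hclose, pow_zero, Place.act_one]
  -- Multiplication by X shifts the values by one place; the two polynomials differ only in the last
  -- value, which sits at X^(m+1) in one and at X^0 in the other.
  refine ⟨C ((Place.act (σ ^ m) Q).eval h), ?_⟩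
  rw [Finset.sum_range_succ, Finset.sum_range_succ', h0]
  simp only [hstep]
  rw [mul_add, Finset.mul_sum]
  have : ∀ j, X * (C ((Place.act (σ ^ j) Q).eval h) * X ^ j) =
      C ((Place.act (σ ^ j) Q).eval h) * X ^ (j + 1) := fun j => by ring
  simp only [this]
  ring

omit hQ in
lemma eval_valuePoly (h : F) (c : k) : (valuePoly σ Q h).eval c =
    ∑ j ∈ Finset.range (Place.orbit σ Q).ncard, (Place.act (σ ^ j) Q).eval h * c ^ j := by
  simp [valuePoly, eval_finsetSum]

omit hQ in
-- The degree is below the orbit length, so divisibility forces the polynomial, and with it all its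
-- coefficients, to vanish.
lemma valuePoly_eq_zero (hper : Q ∈ Function.periodicPts (Place.act σ)) {h : F}
    (hd : (X ^ (Place.orbit σ Q).ncard - 1 : k[X]) ∣ valuePoly σ Q h) :
    ∀ R ∈ Place.orbit σ Q, R.eval h = 0 := by
  have hpos := Function.minimalPeriod_pos_of_mem_periodicPts hper
  have hcard := Place.ncard_orbit σ Q hper
  have hdeg : (valuePoly σ Q h).degree < ((Place.orbit σ Q).ncard : ℕ) := by
    refine (degree_sum_le _ _).trans_lt ?_
    rw [Finset.sup_lt_iff (WithBot.bot_lt_coe _)]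
    intro j hj
    exact (degree_C_mul_X_pow_le _ _).trans_lt (by exact_mod_cast Finset.mem_range.1 hj)
  have h0 : valuePoly σ Q h = 0 := by
    refine eq_zero_of_dvd_of_degree_lt hd ?_
    rwa [← C_1, degree_X_pow_sub_C (by omega)]
  rintro R ⟨j, rfl⟩
  have h1 : Place.act (σ ^ j) Q = Place.act (σ ^ (j % (Place.orbit σ Q).ncard)) Q := by
    rw [Place.act_pow, Place.act_pow, hcard, Function.iterate_mod_minimalPeriod_eq]
  have h2 := congrArg (fun p => p.coeff (j % (Place.orbit σ Q).ncard)) h0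
  simp only [valuePoly, finsetSum_coeff, coeff_C_mul_X_pow, coeff_zero] at h2
  rw [Finset.sum_eq_single (j % (Place.orbit σ Q).ncard)] at h2
  · rw [h1]; simpa using h2
  · intro i _ hi
    rw [if_neg (Ne.symm hi)]
  · intro hi
    exact absurd (Finset.mem_range.2 (Nat.mod_lt _ (by omega))) hi

end ValuePoly

lemma symm_mem_regularOutside {σ : F ≃ₐ[k] F} {P : Place k F} (hσP : Place.act σ P = P) {h : F}
    (hh : h ∈ regularOutside P) :
    σ.symm h ∈ regularOutside P ∧ P.v (σ.symm h) = P.v h := by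
  have hP : P.v (σ.symm h) = P.v h := by
    conv_lhs => rw [← hσP, Place.act_v, AlgEquiv.apply_symm_apply]
  refine ⟨fun R hR => ?_, hP⟩
  have hne : Place.act σ.symm R ≠ P := by
    intro h0
    apply hR
    rw [← hσP, ← h0]
    ext z
    simp [Place.act_v]
  simpa [Place.act_v] using hh _ hne

section Module

variable {σ : F ≃ₐ[k] F} {P : Place k F} (hσP : Place.act σ P = P) {n : ℕ}
  {Q : Fin n → Place k F} (hQ : ∀ i, Place.orbit σ (Q i) ⊆ ratPointsExcept P)
  (hper : ∀ i, Q i ∈ Function.periodicPts (Place.act σ)) (lam : ℕ)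
include hσP hQ hper

/-- The set `codeModule` of a one-point code is a submodule. -/
lemma exists_submodule_codeModule : ∃ M : Submodule k[X] (Fin n → k[X]),
    (M : Set (Fin n → k[X])) = codeModule σ (ratPointsExcept P) Q (onePointCode P lam) := by
  set S := codeModule σ (ratPointsExcept P) Q (onePointCode P lam)
  have hadd : ∀ {p q}, p ∈ S → q ∈ S → p + q ∈ S := by
    intro p q hp hq
    rw [mem_codeModule hQ] at *
    obtain ⟨h₁, h₁r, h₁v, h₁p⟩ := hp
    obtain ⟨h₂, h₂r, h₂v, h₂p⟩ := hq
    refine ⟨h₁ + h₂, add_mem h₁r h₂r, P.v.map_add_le h₁v h₂v, fun i => ?_⟩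
    rw [valuePoly_add (hQ i) h₁r h₂r, Pi.add_apply, add_sub_add_comm]
    exact dvd_add (h₁p i) (h₂p i)
  -- Multiplication by X corresponds to `σ.symm`, which preserves L(lam P) because `σ` fixes `P`.
  have hX : ∀ {p}, p ∈ S → (X : k[X]) • p ∈ S := by
    intro p hp
    rw [mem_codeModule hQ] at *
    obtain ⟨h, hr, hv, hp⟩ := hp
    obtain ⟨h1, h2⟩ := symm_mem_regularOutside hσP hr
    refine ⟨σ.symm h, h1, h2.le.trans hv, fun i => ?_⟩
    have e : ((X : k[X]) • p) i - valuePoly σ (Q i) (σ.symm h) = X * (p i - valuePoly σ (Q i) h) +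
        (X * valuePoly σ (Q i) h - valuePoly σ (Q i) (σ.symm h)) := by
      rw [Pi.smul_apply, smul_eq_mul]; ring
    rw [e]
    exact dvd_add (Dvd.dvd.mul_left (hp i) _) (dvd_X_mul_valuePoly_sub (hper i) h)
  have hC : ∀ (c : k) {p}, p ∈ S → (C c : k[X]) • p ∈ S := by
    intro c p hp
    rw [mem_codeModule hQ] at *
    obtain ⟨h, hr, hv, hp⟩ := hp
    refine ⟨algebraMap k F c * h, mul_mem (Subalgebra.algebraMap_mem _ _) hr, ?_, fun i => ?_⟩
    · rw [map_mul]
      exact (mul_le_of_le_one_left' (P.v_algebraMap_le _)).trans hv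
    · rw [valuePoly_smul (hQ i) hr, Pi.smul_apply, smul_eq_mul, ← mul_sub]
      exact Dvd.dvd.mul_left (hp i) _
  refine ⟨{ carrier := S, add_mem' := hadd, zero_mem' := ?_, smul_mem' := ?_ }, rfl⟩
  · rw [mem_codeModule hQ]
    exact ⟨0, zero_mem _, by simp, fun i => by simp [valuePoly_zero]⟩
  · intro q p hp
    induction q using Polynomial.induction_on with
    | C c => exact hC c hp
    | add q₁ q₂ h1 h2 => rw [add_smul]; exact hadd h1 h2
    | monomial m c ih =>
      rw [pow_succ, ← mul_assoc, mul_comm, mul_smul]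
      exact hX ih

/-- A box is unmarked if and only if it is not a root of some `valuePoly σ (Q i) h`, where `h` lies
in `L(lam P)` and vanishes on the preceding orbits. -/
lemma mem_boxes_diff_markedBoxes {G : Fin n → Fin n → k[X]}
    (hG : IsTriangularGroebnerBasis
      (codeModule σ (ratPointsExcept P) Q (onePointCode P lam)) G) (i : Fin n) {c : k}
    (hc : c ∈ boxes k (Place.orbit σ (Q i)).ncard) :
    c ∉ markedBoxes (Place.orbit σ (Q i)).ncard (G i i) ↔
      ∃ h ∈ regularOutside P, P.v h ≤ exp (lam : ℤ) ∧
        (∀ l < i, ∀ R ∈ Place.orbit σ (Q l), R.eval h = 0) ∧ (valuePoly σ (Q i) h).eval c ≠ 0 := by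
  have hroot : ∀ {p q : k[X]}, (X ^ (Place.orbit σ (Q i)).ncard - 1 : k[X]) ∣ p - q →
      p.eval c = q.eval c := by
    rintro p q ⟨d, hd⟩
    have := congrArg (Polynomial.eval c) hd
    rw [eval_mul, eval_sub, eval_sub, eval_pow, eval_X, eval_one, hc.2, sub_self, zero_mul] at this
    exact sub_eq_zero.1 this
  have hmark : c ∉ markedBoxes (Place.orbit σ (Q i)).ncard (G i i) ↔ (G i i).eval c ≠ 0 := by
    simp [markedBoxes, hc]
  rw [hmark]
  constructor
  · intro hne
    obtain ⟨h, hr, hv, hp⟩ := (mem_codeModule hQ).1 (hG.1 i)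
    refine ⟨h, hr, hv, fun l hl => ?_, by rwa [← hroot (hp i)]⟩
    refine valuePoly_eq_zero (hper l) ?_
    have := hp l
    rw [hG.2.2 i l hl, zero_sub] at this
    exact (dvd_neg).1 this
  · rintro ⟨h, hr, hv, hvan, hne⟩ h0
    obtain ⟨M, hM⟩ := exists_submodule_codeModule hσP hQ hper lam
    rw [← hM] at hG
    have hMem : ∀ {p}, p ∈ M ↔ p ∈ codeModule σ (ratPointsExcept P) Q (onePointCode P lam) := by
      intro p
      rw [← hM]
      rfl
    -- Replacing the earlier components by zero stays in the module, since `h` vanishes on those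
    -- orbits.
    set p : Fin n → k[X] := fun l => if l < i then 0 else valuePoly σ (Q l) h with hp
    have hpM : p ∈ M := by
      rw [hMem, mem_codeModule hQ]
      refine ⟨h, hr, hv, fun l => ?_⟩
      simp only [hp]
      split_ifs with hl
      · have : valuePoly σ (Q l) h = 0 := by
          refine Finset.sum_eq_zero fun j _ => ?_
          rw [hvan l hl _ (Place.act_mem_orbit σ _ j), C_0, zero_mul]
        rw [this]; simp
      · simp
    have hdvd := hG.diag_dvd (fun j => by
      -- The function 0 already puts X^|O_j| - 1 in position `j` into the module, so all diagonal
      -- entries are nonzero.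
      refine ⟨Pi.single j (X ^ (Place.orbit σ (Q j)).ncard - 1), ?_, fun l hl => ?_, ?_⟩
      · rw [hMem, mem_codeModule hQ]
        refine ⟨0, zero_mem _, by simp, fun l => ?_⟩
        rw [valuePoly_zero, sub_zero]
        rcases eq_or_ne l j with rfl | hlj
        · simp
        · simp [Pi.single_eq_of_ne hlj]
      · rw [Pi.single_eq_of_ne hl.ne]
      · rw [Pi.single_eq_same, Place.ncard_orbit σ _ (hper j)]
        exact X_pow_sub_C_ne_zero
          (Function.minimalPeriod_pos_of_mem_periodicPts (hper j)) (1 : k)) hpM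
      (i := i) (fun l hl => by simp [hp, hl])
    apply hne
    obtain ⟨d, hd⟩ := hdvd
    have := congrArg (Polynomial.eval c) hd
    rw [eval_mul, h0, zero_mul] at this
    simpa [hp] using this

end Module

end CodeModule

/-! ### Values of monomials on an orbit, and products of the orbit functions -/

section Rows

variable {k F : Type*} [Field k] [Field F] [Algebra k F]

lemma orderOf_pos_of_ne_zero [Finite k] {α : k} (hα : α ≠ 0) : 0 < orderOf α := by
  have := orderOf_pos (Units.mk0 α hα)
  rwa [← orderOf_units, Units.val_mk0] at this

lemma cast_orderOf_ne_zero [Finite k] {α : k} (hα : α ≠ 0) : ((orderOf α : ℕ) : k) ≠ 0 := by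
  have : NeZero (orderOf α) := ⟨(orderOf_pos_of_ne_zero hα).ne'⟩
  exact (IsPrimitiveRoot.orderOf α).neZero'.out

/-- Sums of powers of a root of unity. -/
lemma geom_sum_ne_zero_iff [Finite k] {α : k} (hα : α ≠ 0) {z : k} (hz : z ^ orderOf α = 1) :
    ∑ j ∈ Finset.range (orderOf α), z ^ j ≠ 0 ↔ z = 1 := by
  constructor
  · intro h
    have h1 := geom_sum_mul z (orderOf α)
    rw [hz, sub_self] at h1
    exact sub_eq_zero.1 ((mul_eq_zero.1 h1).resolve_left h)
  · rintro rfl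
    simpa using cast_orderOf_ne_zero hα

lemma mem_boxes_inv_pow {α : k} (hα : α ≠ 0) (e : ℕ) : (α ^ e)⁻¹ ∈ boxes k (orderOf α) := by
  refine ⟨inv_ne_zero (pow_ne_zero _ hα), ?_⟩
  rw [inv_pow, ← pow_mul, mul_comm, pow_mul, pow_orderOf_eq_one, one_pow, inv_one]

namespace IsPlaneModel

variable {P : Place k F} {a b : ℕ} {f g : k[X]} {x y : F} (H : IsPlaneModel P a b f g x y)
include H

section Automorphism

variable {α : k} {t : ℕ} {σ : F ≃ₐ[k] F} (hσx : σ x = algebraMap k F α * x)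
  (hσy : σ y = algebraMap k F (α ^ t) * y)
include hσx

/-- `P` is the only pole of x, and `σ` multiplies x by a nonzero constant. -/
lemma act_P (hα : α ≠ 0) : Place.act σ P = P := by
  by_contra hne
  have h1 := H.pole_x.mem_regularOutside _ hne
  rw [Place.act_v, hσx, map_mul, P.triv _ hα, one_mul, H.v_x, ← exp_zero, exp_le_exp] at h1
  have := H.pos
  omega

lemma eval_act_x {Q : Place k F} (hQ : Q.IsRational) (hQP : Q ≠ P) (j : ℕ) :
    (Place.act (σ ^ j) Q).eval x = α ^ j * Q.eval x := by
  rw [Place.act_eval, sigma_pow_apply hσx, hQ.eval_mul (Q.v_algebraMap_le _)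
    (H.pole_x.mem_regularOutside _ hQP), Place.eval_algebraMap]

include hσy

lemma sigma_pow_eq_one {j : ℕ} (hj : α ^ j = 1) : σ ^ j = 1 := by
  have hx : (σ ^ j) x = x := by rw [sigma_pow_apply hσx, hj, map_one, one_mul]
  have hy : (σ ^ j) y = y := by
    rw [sigma_pow_apply hσy, ← pow_mul, mul_comm t, pow_mul, hj, one_pow, map_one, one_mul]
  have hp : ∀ p : MvPolynomial (Fin 2) k,
      (σ ^ j) (MvPolynomial.aeval ![x, y] p) = MvPolynomial.aeval ![x, y] p := by
    intro p
    induction p using MvPolynomial.induction_on with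
    | C c => simp
    | add p q hp hq => rw [map_add, map_add, hp, hq]
    | mul_X p i hp =>
      rw [map_mul, map_mul, hp, MvPolynomial.aeval_X]
      congr 1
      fin_cases i
      · exact hx
      · exact hy
  ext h
  obtain ⟨p, q, rfl⟩ := H.exists_div h
  rw [map_div₀, hp, hp, AlgEquiv.one_apply]

lemma isPeriodicPt (Q : Place k F) : Function.IsPeriodicPt (Place.act σ) (orderOf α) Q := by
  rw [Function.IsPeriodicPt, Function.IsFixedPt, ← Place.act_pow,
    H.sigma_pow_eq_one hσx hσy (pow_orderOf_eq_one α), Place.act_one]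

variable [Finite k] (hα : α ≠ 0)
include hα

lemma mem_periodicPts (Q : Place k F) : Q ∈ Function.periodicPts (Place.act σ) :=
  ⟨orderOf α, orderOf_pos_of_ne_zero hα, H.isPeriodicPt hσx hσy Q⟩

section Orbit

variable {Q : Place k F} (hQ : Place.orbit σ Q ⊆ ratPointsExcept P) (hQx : Q.eval x ≠ 0)
include hQ hQx

omit [Finite k] hα in
lemma act_pow_eq_iff (j : ℕ) : Place.act (σ ^ j) Q = Q ↔ α ^ j = 1 := by
  obtain ⟨hr, hP⟩ := act_pow_mem hQ 0
  rw [pow_zero, Place.act_one] at hr hP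
  refine ⟨fun h => ?_, fun h => by rw [H.sigma_pow_eq_one hσx hσy h, Place.act_one]⟩
  have h1 := H.eval_act_x hσx hr hP j
  rw [h] at h1
  exact (mul_eq_right₀ hQx).1 h1.symm

/-- As x(Q) ≠ 0, the coordinate x separates the points of the orbit. -/
lemma ncard_orbit_eq : (Place.orbit σ Q).ncard = orderOf α := by
  rw [Place.ncard_orbit σ Q (H.mem_periodicPts hσx hσy hα Q)]
  refine Nat.dvd_antisymm (H.isPeriodicPt hσx hσy Q).minimalPeriod_dvd ?_
  rw [orderOf_dvd_iff_pow_eq_one, ← H.act_pow_eq_iff hσx hσy hQ hQx, Place.act_pow,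
    Function.iterate_minimalPeriod]

variable (hQy : Q.eval y ≠ 0)
include hQy

lemma eval_valuePoly_monomial_ne_zero (β γ : ℕ) {c : k} (hc : c ∈ boxes k (orderOf α)) :
    (valuePoly σ Q (x ^ β * y ^ γ)).eval c ≠ 0 ↔ c = (α ^ (β + t * γ))⁻¹ := by
  obtain ⟨hr, hP⟩ := act_pow_mem hQ 0
  rw [pow_zero, Place.act_one] at hr hP
  have h1 : (valuePoly σ Q (x ^ β * y ^ γ)).eval c = (Q.eval x ^ β * Q.eval y ^ γ) *
      ∑ j ∈ Finset.range (orderOf α), (α ^ (β + t * γ) * c) ^ j := by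
    rw [eval_valuePoly, H.ncard_orbit_eq hσx hσy hα hQ hQx, Finset.mul_sum]
    refine Finset.sum_congr rfl fun j _ => ?_
    rw [H.eval_act_monomial hσx hσy hr hP, mul_pow]
    ring
  rw [h1, mul_ne_zero_iff, geom_sum_ne_zero_iff hα]
  · rw [and_iff_right (mul_ne_zero (pow_ne_zero _ hQx) (pow_ne_zero _ hQy))]
    exact ⟨eq_inv_of_mul_eq_one_right, fun h => by rw [h, mul_inv_cancel₀ (pow_ne_zero _ hα)]⟩
  · rw [mul_pow, hc.2, ← pow_mul, mul_comm _ (orderOf α), pow_mul, pow_orderOf_eq_one, one_pow,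
      mul_one]

/-- Evaluation of `valuePoly` at `c` is linear in the function, so it suffices to test it on the
spanning monomials. -/
lemma exists_eval_valuePoly_ne_zero_iff (n : ℤ) {c : k} (hc : c ∈ boxes k (orderOf α)) :
    (∃ h ∈ regularOutside P, P.v h ≤ exp n ∧ (valuePoly σ Q h).eval c ≠ 0) ↔
      ∃ β γ : ℕ, β < b ∧ ((β * a + γ * b : ℕ) : ℤ) ≤ n ∧ c = (α ^ (β + t * γ))⁻¹ := by
  constructor
  · rintro ⟨h, hh, hv, hne⟩
    by_contra hno
    have hspan := H.mem_span_monomials n hh hv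
    apply hne
    refine (Submodule.span_induction (p := fun z _ => z ∈ regularOutside P ∧
      (valuePoly σ Q z).eval c = 0) ?_ ?_ ?_ ?_ hspan).2
    · rintro z ⟨β, γ, hβ, hn, rfl⟩
      refine ⟨H.monomial_mem β γ, ?_⟩
      by_contra h0
      exact hno ⟨β, γ, hβ, hn,
        (H.eval_valuePoly_monomial_ne_zero hσx hσy hα hQ hQx hQy β γ hc).1 h0⟩
    · exact ⟨zero_mem _, by rw [valuePoly_zero, eval_zero]⟩
    · rintro z w - - ⟨hz, hz0⟩ ⟨hw, hw0⟩
      exact ⟨add_mem hz hw, by rw [valuePoly_add hQ hz hw, eval_add, hz0, hw0, add_zero]⟩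
    · rintro d z - ⟨hz, hz0⟩
      rw [Algebra.smul_def]
      exact ⟨mul_mem (Subalgebra.algebraMap_mem _ _) hz, by
        rw [valuePoly_smul hQ hz, eval_mul, hz0, mul_zero]⟩
  · rintro ⟨β, γ, hβ, hn, hce⟩
    refine ⟨_, H.monomial_mem β γ, ?_,
      (H.eval_valuePoly_monomial_ne_zero hσx hσy hα hQ hQx hQy β γ hc).2 hce⟩
    rw [H.v_monomial, exp_le_exp]
    exact hn

/-- If every character of the orbit comes from a monomial of pole order at most `n`, then some
polynomial of pole order at most `n` vanishes on the orbit outside the base point. -/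
lemma exists_vanishesExceptAt (n : ℕ) (hall : ∀ e : ℕ, ∃ β γ : ℕ, β * a + γ * b ≤ n ∧
      α ^ e = α ^ (β + t * γ)) :
    ∃ B : MvPolynomial (Fin 2) k, ∃ d ≤ n, VanishesExceptAt σ Q 0 (MvPolynomial.aeval ![x, y] B) ∧
      HasPoleDivisor (MvPolynomial.aeval ![x, y] B) P d := by
  obtain ⟨hr, hP⟩ := act_pow_mem hQ 0
  rw [pow_zero, Place.act_one] at hr hP
  choose β γ hn he using hall
  -- One monomial for each character, scaled to have value 1 at `Q`. The sum of all characters is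
  -- supported at the base point, where it equals the order of `α`, nonzero in `k`.
  set B : MvPolynomial (Fin 2) k := ∑ e ∈ Finset.range (orderOf α),
    MvPolynomial.C (Q.eval x ^ β e * Q.eval y ^ γ e)⁻¹ *
      (MvPolynomial.X 0 ^ β e * MvPolynomial.X 1 ^ γ e) with hB
  have hBa : MvPolynomial.aeval ![x, y] B = ∑ e ∈ Finset.range (orderOf α),
      algebraMap k F (Q.eval x ^ β e * Q.eval y ^ γ e)⁻¹ * (x ^ β e * y ^ γ e) := by
    rw [hB, map_sum]
    refine Finset.sum_congr rfl fun e _ => ?_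
    rw [map_mul, map_mul, map_pow, map_pow, MvPolynomial.aeval_X, MvPolynomial.aeval_X,
      MvPolynomial.aeval_C]
    rfl
  have hreg := H.aeval_mem B
  have hev : ∀ j, (Place.act (σ ^ j) Q).eval (MvPolynomial.aeval ![x, y] B) =
      ∑ e ∈ Finset.range (orderOf α), (α ^ j) ^ e := by
    intro j
    obtain ⟨hRr, hRP⟩ := act_pow_mem hQ j
    have hsum : ∀ S : Finset ℕ, (Place.act (σ ^ j) Q).eval (∑ e ∈ S,
        algebraMap k F (Q.eval x ^ β e * Q.eval y ^ γ e)⁻¹ * (x ^ β e * y ^ γ e)) =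
          ∑ e ∈ S, (α ^ j) ^ e := by
      intro S
      induction S using Finset.induction_on with
      | empty => simpa using (Place.act (σ ^ j) Q).eval_algebraMap (0 : k)
      | insert e S heS ih =>
        have hmem : ∀ e, algebraMap k F (Q.eval x ^ β e * Q.eval y ^ γ e)⁻¹ *
            (x ^ β e * y ^ γ e) ∈ regularOutside P := fun e =>
          mul_mem (Subalgebra.algebraMap_mem _ _) (H.monomial_mem _ _)
        rw [Finset.sum_insert heS, Finset.sum_insert heS,
          hRr.eval_add (hmem e _ hRP) (sum_mem (fun e _ => hmem e) _ hRP), ih,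
          hRr.eval_mul (Place.v_algebraMap_le _ _) (H.monomial_mem _ _ _ hRP),
          Place.eval_algebraMap, H.eval_act_monomial hσx hσy hr hP, ← he]
        have h0 : Q.eval x ^ β e * Q.eval y ^ γ e ≠ 0 :=
          mul_ne_zero (pow_ne_zero _ hQx) (pow_ne_zero _ hQy)
        congr 1
        rw [mul_comm, mul_assoc, mul_inv_cancel₀ h0, mul_one, ← pow_mul, ← pow_mul, mul_comm]
    rw [hBa, hsum]
  have hvan : VanishesExceptAt σ Q 0 (MvPolynomial.aeval ![x, y] B) := by
    rintro R ⟨j, rfl⟩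
    have h1 : (α ^ j) ^ orderOf α = 1 := by
      rw [← pow_mul, mul_comm, pow_mul, pow_orderOf_eq_one, one_pow]
    rw [hev, pow_zero, Place.act_one, Ne, H.act_pow_eq_iff hσx hσy hQ hQx,
      ← geom_sum_ne_zero_iff hα h1, not_not]
  have h0 : MvPolynomial.aeval ![x, y] B ≠ 0 := by
    intro h0
    have h1 := hev 0
    rw [h0, pow_zero, Place.act_one] at h1
    have h2 := Q.eval_algebraMap (0 : k)
    rw [map_zero] at h2
    rw [h2] at h1
    exact (geom_sum_ne_zero_iff hα (one_pow _)).2 rfl (by simpa using h1.symm)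
  refine ⟨B, _, Place.poleOrder_le_of_v_le ?_, hvan, hasPoleDivisor_poleOrder h0 hreg⟩
  rw [hBa]
  refine P.v.map_sum_le fun e _ => ?_
  rw [map_mul, H.v_monomial]
  refine (mul_le_of_le_one_left' (P.v_algebraMap_le _)).trans ?_
  rw [exp_le_exp]
  exact_mod_cast hn e

end Orbit

end Automorphism

end IsPlaneModel

/-! ### Products of functions with disjoint orbits as zeros -/

section Products

variable {P : Place k F} {ι : Type*} {S : ι → Set (Place k F)} {w : ι → F}

/-- A function vanishing on pairwise disjoint sets `S l`, each of which is the divisor of zeros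
of `w l`, is divisible by the product of the `w l`. -/
lemma exists_eq_prod_mul (hS : ∀ l, S l ⊆ ratPointsExcept P)
    (hdisj : ∀ l l', l ≠ l' → ∀ R ∈ S l, R ∉ S l') (hw0 : ∀ l, w l ≠ 0)
    (hw : ∀ l, ∀ R ∈ S l, R.v (w l) = exp (-1 : ℤ)) (hw' : ∀ l, ∀ R ∉ S l, R ≠ P → R.v (w l) = 1)
    (I : Finset ι) {h : F} (hh : h ∈ regularOutside P)
    (hv : ∀ l ∈ I, ∀ R ∈ S l, R.eval h = 0) :
    ∃ h' ∈ regularOutside P, h = (∏ l ∈ I, w l) * h' := by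
  classical
  induction I using Finset.induction_on with
  | empty => exact ⟨h, hh, by simp⟩
  | insert l I hl ih =>
    obtain ⟨h', hh', rfl⟩ := ih fun l' hl' => hv l' (Finset.mem_insert_of_mem hl')
    obtain ⟨h'', hh'', rfl⟩ := exists_eq_mul_of_vanishing (hS l) (hw0 l) (hw l) (hw' l) hh'
      -- The product already split off is a unit at the points of `S l`, so the cofactor inherits
      -- the zeros there.
      (fun R hR => by
        obtain ⟨hr, hP⟩ := hS l hR
        have h1 := (hr.eval_eq_zero_iff (hh R hP)).1 (hv l (Finset.mem_insert_self _ _) R hR)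
        have h2 : R.v (∏ l ∈ I, w l) = 1 := by
          rw [map_prod]
          refine Finset.prod_eq_one fun l' hl' => hw' l' R (hdisj l l' ?_ R hR) hP
          rintro rfl
          exact hl hl'
        rw [map_mul, h2, one_mul] at h1
        exact (hr.eval_eq_zero_iff (hh' R hP)).2 h1)
    exact ⟨h'', hh'', by rw [Finset.prod_insert hl]; ring⟩

lemma exists_eval_prod_eq {T : Set (Place k F)} (hT : T ⊆ ratPointsExcept P)
    (I : Finset ι) (hreg : ∀ l, w l ∈ regularOutside P)
    (hc : ∀ l ∈ I, ∃ c : k, c ≠ 0 ∧ ∀ R ∈ T, R.eval (w l) = c) :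
    ∃ c : k, c ≠ 0 ∧ ∀ R ∈ T, R.eval (∏ l ∈ I, w l) = c := by
  classical
  induction I using Finset.induction_on with
  | empty => exact ⟨1, one_ne_zero, fun R _ => by simpa using R.eval_algebraMap (1 : k)⟩
  | insert l I hl ih =>
    obtain ⟨c, hc0, hcR⟩ := ih fun l' hl' => hc l' (Finset.mem_insert_of_mem hl')
    obtain ⟨d, hd0, hdR⟩ := hc l (Finset.mem_insert_self _ _)
    refine ⟨d * c, mul_ne_zero hd0 hc0, fun R hR => ?_⟩
    obtain ⟨hr, hP⟩ := hT hR
    rw [Finset.prod_insert hl, hr.eval_mul (hreg l R hP) (prod_mem (fun l _ => hreg l) R hP),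
      hdR R hR, hcR R hR]

end Products

lemma valuePoly_mul_of_const {σ : F ≃ₐ[k] F} {P Q : Place k F}
    (hQ : Place.orbit σ Q ⊆ ratPointsExcept P) {w h : F} (hw : w ∈ regularOutside P)
    (hh : h ∈ regularOutside P) {c : k} (hc : ∀ R ∈ Place.orbit σ Q, R.eval w = c) :
    valuePoly σ Q (w * h) = C c * valuePoly σ Q h := by
  rw [valuePoly, valuePoly, Finset.mul_sum]
  refine Finset.sum_congr rfl fun j _ => ?_
  obtain ⟨hr, hP⟩ := act_pow_mem hQ j
  rw [hr.eval_mul (hw _ hP) (hh _ hP), hc _ (Place.act_mem_orbit σ Q j), C_mul, mul_assoc]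

end Rows

/-! ### The curve f(y) = g(x) as a plane model -/

section CoordinateRing

variable {k : Type*} [Field k] {f g : k[X]} {F : Type*} [Field F] [Algebra k F]
  [Algebra (CoordRing f g) F] [IsScalarTower k (CoordRing f g) F]

lemma fn_eq_aeval (p : MvPolynomial (Fin 2) k) :
    fn f g F p = MvPolynomial.aeval ![xFn f g F, yFn f g F] p := by
  let φ : MvPolynomial (Fin 2) k →ₐ[k] F :=
    (IsScalarTower.toAlgHom k (CoordRing f g) F).comp (Ideal.Quotient.mkₐ k _)
  have h1 : φ = MvPolynomial.aeval ![xFn f g F, yFn f g F] := by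
    ext i
    rw [MvPolynomial.aeval_X]
    fin_cases i <;> rfl
  exact congrArg (fun ψ : MvPolynomial (Fin 2) k →ₐ[k] F => ψ p) h1

lemma polyY_eq_aeval (m : k[X]) : polyY f g F m = aeval (yFn f g F) m := by
  rw [polyY, fn_eq_aeval, ← aeval_algHom_apply, MvPolynomial.aeval_X]
  rfl

lemma isPlaneModel_coordRing [IsFractionRing (CoordRing f g) F] {a b : ℕ}
    (hf : f.natDegree = a) (hg : g.natDegree = b) (ha : 0 < a) (hab : a < b)
    (hcop : Nat.Coprime a b) {P : Place k F} (hP : P.IsRational)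
    (hx : HasPoleDivisor (xFn f g F) P a) (hy : HasPoleDivisor (yFn f g F) P b)
    (hH : weierstrassSemigroup P = (AddSubmonoid.closure {a, b} : Set ℕ)) :
    IsPlaneModel P a b f g (xFn f g F) (yFn f g F) where
  rational := hP
  pos := ha
  lt := hab
  coprime := hcop
  natDegree_f := hf
  natDegree_g := hg
  eqn := by
    have h0 : fn f g F (aeval (MvPolynomial.X 1 : MvPolynomial (Fin 2) k) f -
        aeval (MvPolynomial.X 0 : MvPolynomial (Fin 2) k) g) = 0 := by
      rw [fn, Ideal.Quotient.eq_zero_iff_mem.2 (Ideal.mem_span_singleton_self _), map_zero]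
    rw [fn_eq_aeval, map_sub, ← aeval_algHom_apply, ← aeval_algHom_apply, MvPolynomial.aeval_X,
      MvPolynomial.aeval_X] at h0
    exact sub_eq_zero.1 h0
  pole_x := hx
  pole_y := hy
  semigroup := hH
  exists_div := fun h => by
    obtain ⟨u, w, -, rfl⟩ := IsFractionRing.div_surjective (A := CoordRing f g) h
    obtain ⟨p, rfl⟩ := Ideal.Quotient.mk_surjective u
    obtain ⟨q, rfl⟩ := Ideal.Quotient.mk_surjective w
    exact ⟨p, q, by rw [← fn_eq_aeval, ← fn_eq_aeval]; rfl⟩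

end CoordinateRing

end AGCode

theorem mainTheorem1
    -- the curve f(y) = g(x) over the finite field k, with function field F
    {k : Type*} [Field k] [Finite k] (f g : k[X]) (a b : ℕ)
    (hf : f.natDegree = a) (hg : g.natDegree = b) (ha : 0 < a) (hab : a < b)
    (hcop : Nat.Coprime a b)
    {F : Type*} [Field F] [Algebra k F] [Algebra (CoordRing f g) F]
    [IsScalarTower k (CoordRing f g) F] [IsFractionRing (CoordRing f g) F]
    -- the point P
    (P : Place k F) (hP : P.IsRational)
    (hx : HasPoleDivisor (xFn f g F) P a) (hy : HasPoleDivisor (yFn f g F) P b)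
    (hH : weierstrassSemigroup P = (AddSubmonoid.closure {a, b} : Set ℕ))
    -- the automorphism
    (α : k) (hα : α ≠ 0) (t : ℕ) (σ : F ≃ₐ[k] F)
    (hσx : σ (xFn f g F) = algebraMap k F α * xFn f g F)
    (hσy : σ (yFn f g F) = algebraMap k F (α ^ t) * yFn f g F)
    -- the orbits; the first r are those of points with both coordinates nonzero
    (r s : ℕ) (Q : Fin (r + s) → Place k F)
    (hQ : IsOrbitDecomposition σ (ratPointsExcept P) Q)
    (hQr : ∀ i, ((Q i).eval (xFn f g F) ≠ 0 ∧ (Q i).eval (yFn f g F) ≠ 0) ↔ i.val < r)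
    -- the polynomials M_i(y)
    (ρ₁ ρ₂ ρ₃ : ℕ) (M : Fin r → k[X])
    (hMzero : ∀ (i : Fin r) (R : Place k F),
      (R ∈ Place.orbit σ (Q (Fin.castAdd s i)) → R.zeroOrder (polyY f g F (M i)) = 1) ∧
      (R ∉ Place.orbit σ (Q (Fin.castAdd s i)) → R.zeroOrder (polyY f g F (M i)) = 0))
    (hMconst : ∀ (i : Fin r) (l : Fin (r + s)), l ≠ Fin.castAdd s i →
      ∃ c : k, c ≠ 0 ∧ ∀ R ∈ Place.orbit σ (Q l), R.eval (polyY f g F (M i)) = c)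
    (hMpole : ∀ i : Fin r, HasPoleDivisor (polyY f g F (M i)) P (ρ₁ * b))
    -- the polynomials B_{i,j}(x,y)
    (B : Fin r → ℕ → MvPolynomial (Fin 2) k)
    (hB : ∀ (i : Fin r), ∀ j < orderOf α,
      VanishesExceptAt σ (Q (Fin.castAdd s i)) j (fn f g F (B i j)))
    (hBpole : ∀ (i : Fin r), ∀ j < orderOf α,
      HasPoleDivisor (fn f g F (B i j)) P (ρ₂ * a + ρ₃ * b))
    (lam : ℕ) (hlam : lam < Nat.card {R : Place k F // R.IsRational})
    -- the Groebner basis defining the root diagram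
    (G : Fin (r + s) → Fin (r + s) → k[X])
    (hG : IsTriangularGroebnerBasis
      (codeModule σ (ratPointsExcept P) Q (onePointCode P lam)) G)
    -- the row; rows are numbered from 0, so i stands for the row number minus 1
    (i : Fin r) (hlow : i.val * (ρ₁ * b) ≤ lam)
    (hup : lam < (ρ₂ * a + ρ₃ * b) + i.val * (ρ₁ * b)) :
    let m := (Place.orbit σ (Q (Fin.castAdd s i))).ncard
    let marked := markedBoxes m (G (Fin.castAdd s i) (Fin.castAdd s i))
    -- the row is not full
    marked ≠ boxes k m ∧
    -- the row is not empty
    ((∀ j < orderOf α, ∀ (B' : MvPolynomial (Fin 2) k) (n : ℕ),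
        VanishesExceptAt σ (Q (Fin.castAdd s i)) j (fn f g F B') →
        HasPoleDivisor (fn f g F B') P n → ρ₂ * a + ρ₃ * b ≤ n) →
      marked ≠ ∅) ∧
    -- the unmarked boxes
    boxes k m \ marked =
      {c : k | ∃ β γ : ℕ, β < b ∧ γ < ρ₁ ∧ i.val * (ρ₁ * b) + β * a + γ * b ≤ lam ∧
        c = (α ^ (β + γ * b))⁻¹} := by
  intro m marked
  have H := isPlaneModel_coordRing hf hg ha hab hcop hP hx hy hH
  set x := xFn f g F
  set y := yFn f g F
  set i' := Fin.castAdd s i with hi'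
  have hQD := hQ.1
  have hpoly : ∀ l, polyY f g F (M l) = aeval y (M l) := fun l => polyY_eq_aeval _
  simp only [hpoly] at hMzero hMconst hMpole
  obtain ⟨hQx, hQy⟩ := (hQr i').2 i.isLt
  have hαt : α ^ t = α ^ b :=
    H.pow_t_eq_pow_b hσx hσy (hQD i') hQx hQy (hMzero i) (hMpole i) hα
  have hαρ : (α ^ t) ^ ρ₁ = 1 :=
    H.pow_orbit_length hσx hσy (hQD i') hQx hQy (hMzero i) (hMpole i) hα
  have hρ : 0 < ρ₁ := (H.orderOf_le hσy (hQD i') hQy (hMzero i) (hMpole i)).1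
  have hm : m = orderOf α := H.ncard_orbit_eq hσx hσy hα (hQD i') hQx
  set I : Finset (Fin r) := Finset.Iio i with hI
  set W : F := ∏ l ∈ I, aeval y (M l) with hW
  have hIi : i ∉ I := by simp [hI]
  have hWreg : W ∈ regularOutside P := prod_mem fun l _ => (hMpole l).mem_regularOutside
  have hWv : P.v W = WithZero.exp ((i.val * (ρ₁ * b) : ℕ) : ℤ) := by
    have hcard : I.card = i.val := by rw [hI, Fin.card_Iio]
    rw [hW, map_prod, Finset.prod_congr rfl fun l _ =>
      (H.natDegree_orbit_poly (hMzero l) (hMpole l)).2.2, Finset.prod_const, hcard,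
      ← WithZero.exp_nsmul]
    simp
  have hdisj : ∀ l l' : Fin r, l ≠ l' → ∀ R ∈ Place.orbit σ (Q (Fin.castAdd s l)),
      R ∉ Place.orbit σ (Q (Fin.castAdd s l')) := by
    intro l l' hne R hR hR'
    obtain ⟨_, _, hu⟩ := hQ.2 R (hQD _ hR)
    exact hne (Fin.castAdd_injective r s ((hu _ hR).trans (hu _ hR').symm))
  obtain ⟨cW, hcW0, hcW⟩ := exists_eval_prod_eq (hQD i') I
    (fun l => (hMpole l).mem_regularOutside) fun l hl => hMconst l i' fun h => by
      rw [← Fin.castAdd_injective r s h] at hl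
      exact hIi hl
  -- Multiplication by `W` identifies L((lam - iρ₁b)P), with `i` counted from 0, with the functions
  -- in L(lam P) vanishing on the earlier orbits. On O_i it only scales by `cW ≠ 0`.
  have hunmarked : ∀ c ∈ boxes k m, c ∉ marked ↔ ∃ β γ : ℕ, β < b ∧
      i.val * (ρ₁ * b) + β * a + γ * b ≤ lam ∧ c = (α ^ (β + t * γ))⁻¹ := by
    intro c hc
    rw [mem_boxes_diff_markedBoxes (H.act_P hσx hα) hQD
      (fun l => H.mem_periodicPts hσx hσy hα (Q l)) lam hG i' hc]
    have key := H.exists_eval_valuePoly_ne_zero_iff hσx hσy hα (hQD i') hQx hQy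
      ((lam : ℤ) - (i.val * (ρ₁ * b) : ℕ)) (hm ▸ hc)
    have hnum : ∀ β γ : ℕ, ((β * a + γ * b : ℕ) : ℤ) ≤ (lam : ℤ) - (i.val * (ρ₁ * b) : ℕ) ↔
        i.val * (ρ₁ * b) + β * a + γ * b ≤ lam := fun β γ => by omega
    simp only [hnum] at key
    rw [← key]
    have hpole : ∀ h : F, P.v (W * h) ≤ WithZero.exp (lam : ℤ) ↔
        P.v h ≤ WithZero.exp ((lam : ℤ) - (i.val * (ρ₁ * b) : ℕ)) := by
      intro h
      rw [map_mul, hWv, WithZero.exp_sub, le_div_iff₀' WithZero.exp_pos]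
    constructor
    · rintro ⟨h, hr, hv, hvan, hne⟩
      obtain ⟨h', hr', rfl⟩ := exists_eq_prod_mul (P := P)
        (S := fun l : Fin r => Place.orbit σ (Q (Fin.castAdd s l))) (w := fun l => aeval y (M l))
        (fun l => hQD _) hdisj (fun l => (hMpole l).1)
        (fun l R hR => Place.v_eq_of_zeroOrder_eq_one ((hMzero l R).1 hR))
        (fun l R hR hRP => Place.v_eq_one_of_orders (hMpole l).1 ((hMzero l R).2 hR)
          ((hMpole l).2.2 R hRP)) I hr
        (fun l hl R hR => hvan (Fin.castAdd s l) (Fin.lt_def.2 (Fin.lt_def.1 (Finset.mem_Iio.1 hl : l < i))) R hR)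
      refine ⟨h', hr', (hpole h').1 hv, ?_⟩
      rw [valuePoly_mul_of_const (hQD i') hWreg hr' hcW, eval_mul] at hne
      exact right_ne_zero_of_mul hne
    · rintro ⟨h, hr, hv, hne⟩
      refine ⟨W * h, mul_mem hWreg hr, (hpole h).2 hv, fun l hl R hR => ?_, ?_⟩
      · obtain ⟨hRr, hRP⟩ := hQD l hR
        have hlr : l.val < r := lt_trans (by simpa [hi', Fin.lt_def] using hl) i.isLt
        obtain ⟨l', rfl⟩ : ∃ l' : Fin r, l = Fin.castAdd s l' := ⟨⟨l, hlr⟩, rfl⟩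
        have hlI : l' ∈ I := Finset.mem_Iio.2 (Fin.lt_def.2 hl)
        have hw0 : R.eval (aeval y (M l')) = 0 := by
          rw [hRr.eval_eq_zero_iff ((hMpole l').mem_regularOutside _ hRP),
            Place.v_eq_of_zeroOrder_eq_one ((hMzero l' R).1 hR), ← WithZero.exp_zero,
            WithZero.exp_lt_exp]
          norm_num
        rw [hW, ← Finset.mul_prod_erase I _ hlI, mul_assoc,
          hRr.eval_mul ((hMpole l').mem_regularOutside _ hRP)
            (mul_mem (prod_mem fun l _ => (hMpole l).mem_regularOutside) hr _ hRP), hw0, zero_mul]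
      · rw [valuePoly_mul_of_const (hQD i') hWreg hr hcW, eval_mul, eval_C]
        exact mul_ne_zero hcW0 hne
  have hbox : ∀ e : ℕ, (α ^ e)⁻¹ ∈ boxes k m := fun e => hm ▸ mem_boxes_inv_pow hα e
  have hexp : ∀ β γ : ℕ, α ^ (β + t * γ) = α ^ (β + γ * b) := fun β γ => by
    rw [pow_add, pow_add, pow_mul, hαt, ← pow_mul, mul_comm b]
  refine ⟨fun hfull => ?_, fun hmin hempty => ?_, ?_⟩
  -- The box 1 is unmarked, through the trivial monomial; the lower bound on `lam` is exactly what
  -- this needs.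
  · refine (hunmarked _ (hbox 0)).2 ⟨0, 0, H.b_pos, by simpa using hlow, by simp⟩ ?_
    rw [hfull]
    exact hbox 0
  · obtain ⟨B', d, hd, hvan, hdiv⟩ := H.exists_vanishesExceptAt hσx hσy hα (hQD i') hQx hQy
      (lam - i.val * (ρ₁ * b)) fun e => by
        obtain ⟨β, γ, -, hle, he⟩ := (hunmarked _ (hbox e)).1 (by rw [hempty]; exact fun h => h)
        exact ⟨β, γ, by omega, inv_injective he⟩
    rw [← fn_eq_aeval] at hvan hdiv
    have := hmin 0 (orderOf_pos_of_ne_zero hα) B' d hvan hdiv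
    omega
  · ext c
    constructor
    · rintro ⟨hc, hcm⟩
      obtain ⟨β, γ, hβ, hle, rfl⟩ := (hunmarked c hc).1 hcm
      -- Reducing γ modulo `ρ₁` lowers the pole order and keeps the character, because `(α ^ t) ^ ρ₁
      -- = 1`.
      have hγ : γ % ρ₁ * b ≤ γ * b := Nat.mul_le_mul_right _ (Nat.mod_le _ _)
      refine ⟨β, γ % ρ₁, hβ, Nat.mod_lt _ hρ, by omega, ?_⟩
      rw [← hexp, pow_add, pow_add, pow_mul, pow_mul]
      conv_lhs => rw [← Nat.mod_add_div γ ρ₁, pow_add, pow_mul _ ρ₁, hαρ, one_pow, mul_one]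
    · rintro ⟨β, γ, hβ, -, hle, rfl⟩
      exact ⟨hbox _, (hunmarked _ (hbox _)).2 ⟨β, γ, hβ, hle, by rw [hexp]⟩⟩
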